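/- Let $n\ge 1$, let $B(x,r)\subset\mathbb{R}^n$ be the ball of centre $x$ and radius $r$, and $|B(x,r)|$ its Lebesgue measure. A Young function is a convex, left-continuous $\Phi:[0,\infty)\to[0,\infty]$ with $\lim_{r\to0+}\Phi(r)=\Phi(0)=0$ and $\lim_{r\to\infty}\Phi(r)=\infty$; put $\Phi^{-1}(s)=\inf\{r\ge0:\Phi(r)>s\}$. Write $\Phi\in\Delta'$ if for some $C>1$, $\Phi(tr)\le C\,\Phi(t)\Phi(r)$ for all $t,r\ge0$, and $\Phi\in\nabla_2$ if for some $C>1$, $\Phi(r)\le\frac1{2C}\Phi(Cr)$ for all $r\ge0$. The space $L^\Phi(\mathbb{R}^n)$ consists of all $f\in L^1_{\rm loc}(\mathbb{R}^n)$ with $\int_{\mathbb{R}^n}\Phi(k|f|)\,dx<\infty$ for some $k>0$, with norm $\|f\|_{L^\Phi}=\inf\{\lambda>0:\int_{\mathbb{R}^n}\Phi(|f|/\lambda)\,dx\le1\}$, and $f\in L^\Phi_{\rm loc}$ means $f\chi_B\in L^\Phi$ for all balls $B$. For a positive measurable function $\varphi$ on $\mathbb{R}^n\times(0,\infty)$,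 $\mathcal{M}^{\Phi,\varphi}(\mathbb{R}^n)$ is the space of all $f\in L^\Phi_{\rm loc}$ with $$\|f\|_{\mathcal{M}^{\Phi,\varphi}}=\sup_{x\in\mathbb{R}^n,\,r>0}\varphi(x,r)^{-1}\,\Phi^{-1}\big(|B(x,r)|^{-1}\big)\,\|f\chi_{B(x,r)}\|_{L^\Phi}<\infty .$$ Let $\Omega_\Phi$ be the set of all positive measurable $\varphi$ on $\mathbb{R}^n\times(0,\infty)$ such that for every $t>0$ $$\sup_{x\in\mathbb{R}^n}\Big\|\frac{\Phi^{-1}(|B(x,\cdot)|^{-1})}{\varphi(x,\cdot)}\Big\|_{L^\infty(t,\infty)}<\infty\quad\text{and}\quad\sup_{x\in\mathbb{R}^n}\big\|\varphi(x,\cdot)^{-1}\big\|_{L^\infty(0,t)}<\infty .$$ For $0<\alpha<n$ let $M_\alpha f(x)=\sup_{t>0}|B(x,t)|^{-1+\alpha/n}\int_{B(x,t)}|f(y)|\,dy$. **Theorem.** Let $0<\alpha<n$, $\beta\in(0,1)$, let $\Phi$ be a Young function with $\Phi\in\Delta'\cap\nabla_2$, and let $\varphi\in\Omega_\Phi$.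 Suppose that there is a constant $C$ such that for all $x\in\mathbb{R}^n$ and $r>0$ $$\sup_{r<t<\infty}\Phi^{-1}\big(|B(x,t)|^{-1}\big)\operatorname*{ess\,inf}_{t<s<\infty}\frac{\varphi(x,s)}{\Phi^{-1}(|B(x,s)|^{-1})}\le C\,\varphi(x,r)$$ and $$r^\alpha\varphi(x,r)+\sup_{r<t<\infty}t^\alpha\varphi(x,t)\le C\,\varphi(x,r)^\beta .$$ Put $\eta(x,r)=\varphi(x,r)^\beta$ and $\Psi(r)=\Phi(r^{1/\beta})$. Then $M_\alpha$ is bounded from $\mathcal{M}^{\Phi,\varphi}(\mathbb{R}^n)$ to $\mathcal{M}^{\Psi,\eta}(\mathbb{R}^n)$: there is a constant $C'$ such that for every $f\in\mathcal{M}^{\Phi,\varphi}(\mathbb{R}^n)$ the function $M_\alpha f$ is finite almost everywhere, belongs to $\mathcal{M}^{\Psi,\eta}(\mathbb{R}^n)$, and satisfies $\|M_\alpha f\|_{\mathcal{M}^{\Psi,\eta}}\le C'\|f\|_{\mathcal{M}^{\Phi,\varphi}}$. -/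

import Mathlib

open MeasureTheory Set Filter Topology
open scoped NNReal ENNReal

/-- Young functions `Φ : [0,∞) → [0,∞]`: convex, left-continuous,
`lim_{r → 0+} Φ(r) = Φ(0) = 0` and `lim_{r → ∞} Φ(r) = ∞`. -/
structure IsYoungFunction (Φ : ℝ≥0 → ℝ≥0∞) : Prop where
  convex : ConvexOn ℝ≥0 univ Φ
  leftCont : ∀ r, ContinuousWithinAt Φ (Iio r) r
  map_zero : Φ 0 = 0
  tendsto_zero : Tendsto Φ (𝓝[>] 0) (𝓝 0)
  tendsto_top : Tendsto Φ atTop (𝓝 ∞)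

/-- The condition `Φ ∈ Δ'`: `Φ(t r) ≤ C Φ(t) Φ(r)` for all `t, r ≥ 0`, for some `C > 1`. -/
def DeltaPrime (Φ : ℝ≥0 → ℝ≥0∞) : Prop :=
  ∃ C : ℝ≥0, 1 < C ∧ ∀ t r : ℝ≥0, Φ (t * r) ≤ C * Φ t * Φ r

/-- The condition `Φ ∈ ∇₂`: `Φ(r) ≤ Φ(C r) / (2C)` for all `r ≥ 0`, for some `C > 1`. -/
def NablaTwo (Φ : ℝ≥0 → ℝ≥0∞) : Prop :=
  ∃ C : ℝ≥0, 1 < C ∧ ∀ r : ℝ≥0, Φ r ≤ (2 * (C : ℝ≥0∞))⁻¹ * Φ (C * r)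

/-- The generalized inverse `Φ⁻¹(s) = inf {r ≥ 0 : Φ(r) > s}`, for `0 ≤ s ≤ ∞`
(with `inf ∅ = ∞`). -/
noncomputable def youngInv (Φ : ℝ≥0 → ℝ≥0∞) (s : ℝ≥0∞) : ℝ≥0∞ :=
  ⨅ (r : ℝ≥0) (_ : s < Φ r), (r : ℝ≥0∞)

/-- The quantity `Φ⁻¹(|B(x,r)|⁻¹)`. -/
noncomputable def youngInvBall {n : ℕ} (Φ : ℝ≥0 → ℝ≥0∞)
    (x : EuclideanSpace ℝ (Fin n)) (r : ℝ) : ℝ≥0∞ :=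
  youngInv Φ (volume (Metric.ball x r))⁻¹

/-- The Luxemburg norm `‖f‖_{L^Φ} = inf {λ > 0 : ∫ Φ(|f(x)| / λ) dx ≤ 1}` on `ℝⁿ`,
with value in `[0,∞]`. -/
noncomputable def luxemburgNorm {n : ℕ} {F : Type*} [NormedAddCommGroup F] (Φ : ℝ≥0 → ℝ≥0∞)
    (f : EuclideanSpace ℝ (Fin n) → F) : ℝ≥0∞ :=
  ⨅ (l : ℝ≥0) (_ : 0 < l) (_ : ∫⁻ x, Φ (‖f x‖₊ / l) ≤ 1), (l : ℝ≥0∞)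

/-- Membership in the Orlicz space `L^Φ(ℝⁿ)`. -/
def MemOrlicz {n : ℕ} {F : Type*} [NormedAddCommGroup F] (Φ : ℝ≥0 → ℝ≥0∞)
    (f : EuclideanSpace ℝ (Fin n) → F) : Prop :=
  LocallyIntegrable f volume ∧ ∃ k : ℝ≥0, 0 < k ∧ ∫⁻ x, Φ (k * ‖f x‖₊) < ∞

/-- Membership in `L^Φ_loc(ℝⁿ)`: `f χ_B ∈ L^Φ(ℝⁿ)` for all balls `B`. -/
def MemOrliczLoc {n : ℕ} {F : Type*} [NormedAddCommGroup F] (Φ : ℝ≥0 → ℝ≥0∞)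
    (f : EuclideanSpace ℝ (Fin n) → F) : Prop :=
  ∀ (x : EuclideanSpace ℝ (Fin n)) (r : ℝ), 0 < r →
    MemOrlicz Φ ((Metric.ball x r).indicator f)

/-- The norm of the generalized Orlicz-Morrey space `M^{Φ,φ}(ℝⁿ)`,
`sup_{x, r > 0} φ(x,r)⁻¹ Φ⁻¹(|B(x,r)|⁻¹) ‖f χ_{B(x,r)}‖_{L^Φ}`, with value in `[0,∞]`. -/
noncomputable def orliczMorreyNorm {n : ℕ} {F : Type*} [NormedAddCommGroup F]
    (Φ : ℝ≥0 → ℝ≥0∞) (φ : EuclideanSpace ℝ (Fin n) → ℝ → ℝ)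
    (f : EuclideanSpace ℝ (Fin n) → F) : ℝ≥0∞ :=
  ⨆ (x : EuclideanSpace ℝ (Fin n)) (r : ℝ) (_ : 0 < r),
    (ENNReal.ofReal (φ x r))⁻¹ * youngInvBall Φ x r *
      luxemburgNorm Φ ((Metric.ball x r).indicator f)

/-- Membership in the generalized Orlicz-Morrey space `M^{Φ,φ}(ℝⁿ)`. -/
def MemOrliczMorrey {n : ℕ} {F : Type*} [NormedAddCommGroup F]
    (Φ : ℝ≥0 → ℝ≥0∞) (φ : EuclideanSpace ℝ (Fin n) → ℝ → ℝ)
    (f : EuclideanSpace ℝ (Fin n) → F) : Prop :=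
  MemOrliczLoc Φ f ∧ orliczMorreyNorm Φ φ f < ∞

/-- The class `Ω_Φ` of weights `φ` on `ℝⁿ × (0,∞)`; only the values `φ x r` with `r > 0`
matter. Measurability is Lebesgue measurability on `ℝⁿ × (0,∞)`. -/
structure MemOmega {n : ℕ} (Φ : ℝ≥0 → ℝ≥0∞)
    (φ : EuclideanSpace ℝ (Fin n) → ℝ → ℝ) : Prop where
  pos : ∀ x r, 0 < r → 0 < φ x r
  meas : NullMeasurable (fun p : EuclideanSpace ℝ (Fin n) × ℝ => φ p.1 p.2)
    (volume.restrict (univ ×ˢ Ioi 0))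
  bound_large : ∀ t : ℝ, 0 < t →
    ⨆ x : EuclideanSpace ℝ (Fin n),
      essSup (fun r => youngInvBall Φ x r / ENNReal.ofReal (φ x r))
        (volume.restrict (Ioi t)) < ∞
  bound_small : ∀ t : ℝ, 0 < t →
    ⨆ x : EuclideanSpace ℝ (Fin n),
      essSup (fun r => (ENNReal.ofReal (φ x r))⁻¹) (volume.restrict (Ioo 0 t)) < ∞

/-- The supremal condition
`sup_{r<t<∞} Φ⁻¹(|B(x,t)|⁻¹) essinf_{t<s<∞} φ(x,s) / Φ⁻¹(|B(x,s)|⁻¹) ≤ C φ(x,r)`,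
with `C` independent of `x` and `r > 0`. -/
def SupremalCondition {n : ℕ} (Φ : ℝ≥0 → ℝ≥0∞)
    (φ : EuclideanSpace ℝ (Fin n) → ℝ → ℝ) : Prop :=
  ∃ C : ℝ≥0, ∀ (x : EuclideanSpace ℝ (Fin n)) (r : ℝ), 0 < r →
    ⨆ (t : ℝ) (_ : r < t), youngInvBall Φ x t *
        essInf (fun s => ENNReal.ofReal (φ x s) / youngInvBall Φ x s)
          (volume.restrict (Ioi t))
      ≤ C * ENNReal.ofReal (φ x r)

/-- The condition `r^α φ(x,r) + sup_{r<t<∞} t^α φ(x,t) ≤ C φ(x,r)^β`,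
with `C` independent of `x` and `r > 0`. -/
def AdamsCondition {n : ℕ} (α β : ℝ) (φ : EuclideanSpace ℝ (Fin n) → ℝ → ℝ) : Prop :=
  ∃ C : ℝ≥0, ∀ (x : EuclideanSpace ℝ (Fin n)) (r : ℝ), 0 < r →
    ENNReal.ofReal (r ^ α * φ x r) +
        ⨆ (t : ℝ) (_ : r < t), ENNReal.ofReal (t ^ α * φ x t)
      ≤ C * ENNReal.ofReal (φ x r ^ β)

/-- The fractional maximal function
`M_α f(x) = sup_{t>0} |B(x,t)|^{-1+α/n} ∫_{B(x,t)} |f(y)| dy`, with value in `[0,∞]`. -/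
noncomputable def fracMaximal {n : ℕ} {F : Type*} [NormedAddCommGroup F] (α : ℝ)
    (f : EuclideanSpace ℝ (Fin n) → F) (x : EuclideanSpace ℝ (Fin n)) : ℝ≥0∞ :=
  ⨆ (t : ℝ) (_ : 0 < t),
    volume (Metric.ball x t) ^ (-1 + α / (n : ℝ)) * ∫⁻ y in Metric.ball x t, ‖f y‖ₑ

/-! ### Young functions and their extension to `[0,∞]` -/

section Young

variable {Φ : ℝ≥0 → ℝ≥0∞}

/-! The proof is a Hedberg argument. Write `N` for the Morrey norm of `f` and `M` for the
Hardy-Littlewood maximal operator. The average of `|f|` over `B(x,t)` is at most `M f(x)`, and by a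
Hölder-type inequality also at most `2 φ(x,t) N`. Taking the geometric mean of the two bounds with
weights `β` and `1 - β`, and using `t^α φ(x,t)^(1-β) ≤ C`, one gets `M_α f ≤ D N^(1-β) (M f)^β` at
every point (`exists_powMaximal_le_rpow`). Since `Ψ(r) = Φ(r^(1/β))` and `η = φ^β`, the `(Ψ,η)` norm
of `(M f)^β` is controlled by the `β`-th power of the `(Φ,φ)` norm of `M f`, so it remains to bound
`M` on the space with parameters `(Φ,φ)`.

For that, on `B(x,r)` the function `M f` is at most the maximum of `M (f χ_{B(x,2r)})` and a
constant (`hlMaximal_le_max_of_mem_ball`). The first is handled by boundedness of `M` on `L^Φ`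
(`exists_eLuxemburg_hlMaximal_le`), which follows from the weak (1,1) inequality and `∇₂`. The
second is handled by the supremal condition (`youngInvBall_mul_eLuxemburg_le_of_supremal`).

Maximal functions take values in `[0,∞]`, so `Φ` and its norm are extended there (`youngExt`,
`eLuxemburg`). -/

theorem IsYoungFunction.mul_le_map_mul (h : IsYoungFunction Φ) {t : ℝ≥0} (ht : 1 ≤ t) (r : ℝ≥0) :
    t * Φ r ≤ Φ (t * r) := by
  have ht0 : t ≠ 0 := (zero_lt_one.trans_le ht).ne'
  have hi : t⁻¹ ≤ 1 := inv_le_one_of_one_le₀ ht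
  have := h.convex.2 (mem_univ (t * r)) (mem_univ 0) (zero_le (a := t⁻¹))
    (zero_le (a := 1 - t⁻¹)) (add_tsub_cancel_of_le hi)
  simp only [smul_eq_mul, mul_zero, add_zero, h.map_zero, smul_zero,
    inv_mul_cancel_left₀ ht0, ENNReal.smul_def] at this
  calc (t : ℝ≥0∞) * Φ r ≤ t * ((t⁻¹ : ℝ≥0) * Φ (t * r)) := by gcongr
    _ = Φ (t * r) := by
      rw [← mul_assoc, ← ENNReal.coe_mul, mul_inv_cancel₀ ht0, ENNReal.coe_one, one_mul]

theorem IsYoungFunction.monotone (h : IsYoungFunction Φ) : Monotone Φ := by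
  intro r s hrs
  rcases eq_or_ne r 0 with rfl | hr
  · simp [h.map_zero]
  have h1 : 1 ≤ s / r := (one_le_div (pos_iff_ne_zero.2 hr)).2 hrs
  have := h.mul_le_map_mul h1 r
  rw [div_mul_cancel₀ _ hr] at this
  refine le_trans ?_ this
  have h2 : (1 : ℝ≥0∞) ≤ (s / r : ℝ≥0) := by exact_mod_cast h1
  simpa using mul_le_mul_left h2 (Φ r)

/-- Superlinearity of `Φ` makes its inverse sublinear; this is the source of the doubling property
of `youngInvBall`. -/
theorem youngInv_mono_of_mul (h : IsYoungFunction Φ) {t : ℝ≥0} (ht : 1 ≤ t) {s : ℝ≥0∞} :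
    youngInv Φ (t * s) ≤ t * youngInv Φ s := by
  have ht0 : t ≠ 0 := (zero_lt_one.trans_le ht).ne'
  have ht0' : (t : ℝ≥0∞) ≠ 0 := by exact_mod_cast ht0
  rw [mul_comm (t : ℝ≥0∞) (youngInv Φ s), ← ENNReal.div_le_iff ht0' ENNReal.coe_ne_top]
  refine le_iInf₂ fun r hr => ?_
  rw [ENNReal.div_le_iff ht0' ENNReal.coe_ne_top]
  refine iInf₂_le_of_le (t * r) ?_ (by rw [ENNReal.coe_mul, mul_comm])
  exact lt_of_lt_of_le (ENNReal.mul_lt_mul_right ht0' ENNReal.coe_ne_top hr)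
    (h.mul_le_map_mul ht r)

theorem youngInv_lt_top (h : IsYoungFunction Φ) {s : ℝ≥0∞} (hs : s < ∞) : youngInv Φ s < ∞ := by
  obtain ⟨r, hr⟩ := (h.tendsto_top.eventually (lt_mem_nhds hs)).exists
  exact (iInf₂_le r hr).trans_lt ENNReal.coe_lt_top

theorem youngInv_pos (h : IsYoungFunction Φ) {s : ℝ≥0∞} (hs : 0 < s) : 0 < youngInv Φ s := by
  obtain ⟨r, hr, hr0⟩ := ((h.tendsto_zero.eventually (gt_mem_nhds hs)).and
    self_mem_nhdsWithin).exists
  have hr0' : (0 : ℝ≥0∞) < r := by exact_mod_cast (show (0 : ℝ≥0) < r from hr0)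
  refine hr0'.trans_le (le_iInf₂ fun q hq => ?_)
  by_contra! hlt
  exact absurd (hq.trans_le (h.monotone (by exact_mod_cast hlt.le))) hr.not_gt

/-- The monotone extension of `Φ` to `[0,∞]`. -/
noncomputable def youngExt (Φ : ℝ≥0 → ℝ≥0∞) (u : ℝ≥0∞) : ℝ≥0∞ :=
  ⨆ (r : ℝ≥0) (_ : (r : ℝ≥0∞) ≤ u), Φ r

theorem le_youngExt {r : ℝ≥0} {u : ℝ≥0∞} (hr : (r : ℝ≥0∞) ≤ u) : Φ r ≤ youngExt Φ u :=
  le_iSup₂_of_le r hr le_rfl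

theorem youngExt_mono : Monotone (youngExt Φ) := fun _ _ huv =>
  iSup₂_le fun _ hr => le_youngExt (hr.trans huv)

theorem measurable_youngExt : Measurable (youngExt Φ) := youngExt_mono.measurable

theorem youngExt_coe (h : IsYoungFunction Φ) (r : ℝ≥0) : youngExt Φ r = Φ r :=
  le_antisymm (iSup₂_le fun _ hq => h.monotone (by exact_mod_cast hq)) (le_youngExt le_rfl)

theorem youngExt_zero (h : IsYoungFunction Φ) : youngExt Φ 0 = 0 := by
  simpa [h.map_zero] using youngExt_coe h 0

theorem youngExt_top (h : IsYoungFunction Φ) : youngExt Φ ∞ = ∞ := by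
  refine ENNReal.eq_top_of_forall_nnreal_le fun c => ?_
  obtain ⟨r, hr⟩ := (h.tendsto_top.eventually (lt_mem_nhds (ENNReal.coe_lt_top (r := c)))).exists
  exact hr.le.trans (le_youngExt le_top)

/-- This lets a constant in front of a modular move inside `Φ`, so modular inequalities become norm
inequalities. -/
theorem mul_youngExt_le (h : IsYoungFunction Φ) {t : ℝ≥0∞} (ht : 1 ≤ t) (u : ℝ≥0∞) :
    t * youngExt Φ u ≤ youngExt Φ (t * u) := by
  induction t with
  | top =>
    rcases eq_or_ne u 0 with rfl | hu
    · simp [youngExt_zero h]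
    · rw [ENNReal.top_mul hu, youngExt_top h]; exact le_top
  | coe t =>
    simp only [youngExt, ENNReal.mul_iSup]
    refine iSup₂_le fun r hr => ?_
    refine (h.mul_le_map_mul (by exact_mod_cast ht) r).trans (le_youngExt ?_)
    rw [ENNReal.coe_mul]; gcongr

/-- Either `u ≤ r`, or superlinearity gives `(u / r) Φ(r) ≤ Φ(u)` with `Φ(r) > s`. This linear bound
takes the place of Young's inequality with the conjugate function. -/
theorem le_mul_one_add_youngExt (h : IsYoungFunction Φ) {s : ℝ≥0∞} (hs0 : s ≠ 0) (hs : s ≠ ∞)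
    {r : ℝ≥0} (hr : s < Φ r) (u : ℝ≥0∞) : u ≤ r * (1 + youngExt Φ u / s) := by
  have hr0 : (r : ℝ≥0∞) ≠ 0 := by
    rintro h0
    rw [ENNReal.coe_eq_zero.1 h0, h.map_zero] at hr
    exact absurd hr not_lt_zero
  rcases le_total u r with hu | hu
  · exact hu.trans (le_mul_of_one_le_right' (le_add_right le_rfl))
  have h1 : 1 ≤ u / r := by
    rwa [ENNReal.le_div_iff_mul_le (Or.inl hr0) (Or.inl ENNReal.coe_ne_top), one_mul]
  have h2 := mul_youngExt_le h h1 r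
  rw [ENNReal.div_mul_cancel hr0 ENNReal.coe_ne_top, youngExt_coe h] at h2
  have h3 : u / r ≤ youngExt Φ u / s := by
    rw [ENNReal.le_div_iff_mul_le (Or.inl hs0) (Or.inl hs)]
    exact le_trans (by gcongr) h2
  calc u = r * (u / r) := (ENNReal.mul_div_cancel hr0 ENNReal.coe_ne_top).symm
    _ ≤ r * (1 + youngExt Φ u / s) := by gcongr; exact h3.trans le_add_self

end Young

/-! ### The Luxemburg functional for `[0,∞]`-valued functions -/

section Luxemburg

variable {n : ℕ} {Φ : ℝ≥0 → ℝ≥0∞}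

/-- The Luxemburg functional of a function with values in `[0,∞]`. -/
noncomputable def eLuxemburg (Φ : ℝ≥0 → ℝ≥0∞) (g : EuclideanSpace ℝ (Fin n) → ℝ≥0∞) : ℝ≥0∞ :=
  ⨅ (l : ℝ≥0) (_ : 0 < l) (_ : ∫⁻ x, youngExt Φ (g x / l) ≤ 1), (l : ℝ≥0∞)

theorem eLuxemburg_le {g : EuclideanSpace ℝ (Fin n) → ℝ≥0∞} {l : ℝ≥0} (hl : 0 < l)
    (h : ∫⁻ x, youngExt Φ (g x / l) ≤ 1) : eLuxemburg Φ g ≤ l :=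
  iInf_le_of_le l (iInf₂_le_of_le hl h le_rfl)

theorem exists_of_eLuxemburg_lt {g : EuclideanSpace ℝ (Fin n) → ℝ≥0∞} {L : ℝ≥0∞}
    (h : eLuxemburg Φ g < L) :
    ∃ l : ℝ≥0, 0 < l ∧ (l : ℝ≥0∞) < L ∧ ∫⁻ x, youngExt Φ (g x / l) ≤ 1 := by
  simp only [eLuxemburg, iInf_lt_iff] at h
  obtain ⟨l, hl, hi, hL⟩ := h
  exact ⟨l, hl, hL, hi⟩

theorem eLuxemburg_mono {g g' : EuclideanSpace ℝ (Fin n) → ℝ≥0∞} (h : ∀ x, g x ≤ g' x) :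
    eLuxemburg Φ g ≤ eLuxemburg Φ g' := by
  refine le_iInf fun l => le_iInf₂ fun hl hi => eLuxemburg_le hl (le_trans ?_ hi)
  exact lintegral_mono fun x => youngExt_mono (by gcongr; exact h x)

theorem luxemburgNorm_eq_eLuxemburg {F : Type*} [NormedAddCommGroup F] (h : IsYoungFunction Φ)
    (f : EuclideanSpace ℝ (Fin n) → F) : luxemburgNorm Φ f = eLuxemburg Φ fun x => ‖f x‖ₑ := by
  refine iInf_congr fun l => iInf_congr fun hl => ?_
  have : ∀ x, youngExt Φ (‖f x‖ₑ / l) = Φ (‖f x‖₊ / l) := fun x => by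
    rw [← youngExt_coe h, ENNReal.coe_div hl.ne', enorm_eq_nnnorm]
  simp only [this]

/-- Dividing by `2 (l₁ + l₂)` instead of `l₁` or `l₂` halves each modular by superlinearity, and the
two halves add up to at most one. -/
theorem eLuxemburg_max_le (h : IsYoungFunction Φ) {g g' : EuclideanSpace ℝ (Fin n) → ℝ≥0∞}
    (hg : Measurable g) :
    eLuxemburg Φ (fun x => max (g x) (g' x)) ≤ 2 * (eLuxemburg Φ g + eLuxemburg Φ g') := by
  have key : ∀ l₁ l₂ : ℝ≥0, 0 < l₁ → 0 < l₂ → (∫⁻ x, youngExt Φ (g x / l₁) ≤ 1) →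
      (∫⁻ x, youngExt Φ (g' x / l₂) ≤ 1) →
      eLuxemburg Φ (fun x => max (g x) (g' x)) ≤ 2 * (l₁ + l₂ : ℝ≥0∞) := by
    intro l₁ l₂ h₁ h₂ hi₁ hi₂
    have half : ∀ (l : ℝ≥0), 0 < l → l ≤ l₁ + l₂ → ∀ u : ℝ≥0∞,
        youngExt Φ (u / (2 * (l₁ + l₂) : ℝ≥0)) ≤ 2⁻¹ * youngExt Φ (u / l) := by
      intro l hl hle u
      have hl0 : (l : ℝ≥0∞) ≠ 0 := by exact_mod_cast hl.ne'
      have := mul_youngExt_le h (t := 2) one_le_two (u / (2 * (l₁ + l₂) : ℝ≥0))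
      have h3 : (2 : ℝ≥0∞) * (u / (2 * (l₁ + l₂) : ℝ≥0)) ≤ u / l := by
        have e : (2 : ℝ≥0∞) * (u / (2 * (l₁ + l₂) : ℝ≥0)) = u / (l₁ + l₂ : ℝ≥0) := by
          rw [ENNReal.coe_mul, ENNReal.coe_ofNat, ← mul_div_assoc,
            ENNReal.mul_div_mul_left _ _ two_ne_zero ENNReal.ofNat_ne_top]
        rw [e]; gcongr
      calc _ = 2⁻¹ * (2 * youngExt Φ (u / (2 * (l₁ + l₂) : ℝ≥0))) := by
            rw [← mul_assoc, ENNReal.inv_mul_cancel two_ne_zero ENNReal.ofNat_ne_top, one_mul]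
        _ ≤ _ := by gcongr; exact this.trans (youngExt_mono h3)
    have : (2 * (l₁ + l₂ : ℝ≥0∞)) = ((2 * (l₁ + l₂) : ℝ≥0) : ℝ≥0∞) := by push_cast; rfl
    rw [this]
    refine eLuxemburg_le (by positivity) ?_
    calc ∫⁻ x, youngExt Φ (max (g x) (g' x) / (2 * (l₁ + l₂) : ℝ≥0))
        ≤ ∫⁻ x, (2⁻¹ * youngExt Φ (g x / l₁) + 2⁻¹ * youngExt Φ (g' x / l₂)) := by
          refine lintegral_mono fun x => ?_
          rcases max_choice (g x) (g' x) with hm | hm <;> rw [hm]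
          · exact (half l₁ h₁ le_self_add _).trans le_self_add
          · exact (half l₂ h₂ le_add_self _).trans le_add_self
      _ = 2⁻¹ * (∫⁻ x, youngExt Φ (g x / l₁)) + 2⁻¹ * ∫⁻ x, youngExt Φ (g' x / l₂) := by
          have hm : Measurable fun x => 2⁻¹ * youngExt Φ (g x / l₁) :=
            (measurable_youngExt.comp (hg.div_const _)).const_mul _
          rw [lintegral_add_left hm, lintegral_const_mul' _ _ (by simp),
            lintegral_const_mul' _ _ (by simp)]
      _ ≤ 2⁻¹ * 1 + 2⁻¹ * 1 := by gcongr
      _ = 1 := by simp [ENNReal.inv_two_add_inv_two]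
  refine le_of_forall_gt_imp_ge_of_dense fun c hc => ?_
  rw [mul_comm, ← ENNReal.lt_div_iff_mul_lt (by simp) (by simp)] at hc
  obtain ⟨a, b, ha, hb, hab⟩ : ∃ a b : ℝ≥0∞, eLuxemburg Φ g < a ∧ eLuxemburg Φ g' < b ∧
      a + b ≤ c / 2 := by
    obtain ⟨ε, hε, hlt⟩ := ENNReal.lt_iff_exists_add_pos_lt.1 hc
    have hfin := ENNReal.add_ne_top.1 (le_self_add.trans_lt hlt).ne_top
    have hε2 : ((ε / 2 : ℝ≥0) : ℝ≥0∞) ≠ 0 := by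
      have : 0 < ε / 2 := by positivity
      exact_mod_cast this.ne'
    refine ⟨eLuxemburg Φ g + (ε / 2 : ℝ≥0), eLuxemburg Φ g' + (ε / 2 : ℝ≥0),
      ENNReal.lt_add_right hfin.1 hε2, ENNReal.lt_add_right hfin.2 hε2, le_trans (le_of_eq ?_) hlt.le⟩
    rw [add_add_add_comm, ← ENNReal.coe_add, add_halves]
  obtain ⟨l₁, h₁, h₁a, hi₁⟩ := exists_of_eLuxemburg_lt ha
  obtain ⟨l₂, h₂, h₂b, hi₂⟩ := exists_of_eLuxemburg_lt hb
  refine (key l₁ l₂ h₁ h₂ hi₁ hi₂).trans ?_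
  calc 2 * (l₁ + l₂ : ℝ≥0∞) ≤ 2 * (a + b) := by gcongr
    _ ≤ 2 * (c / 2) := by gcongr
    _ = c := ENNReal.mul_div_cancel two_ne_zero ENNReal.ofNat_ne_top

theorem ae_lt_top_of_eLuxemburg_lt_top (h : IsYoungFunction Φ)
    {g : EuclideanSpace ℝ (Fin n) → ℝ≥0∞} (hg : Measurable g) (hfin : eLuxemburg Φ g < ∞) :
    ∀ᵐ x, g x < ∞ := by
  obtain ⟨l, hl, -, hi⟩ := exists_of_eLuxemburg_lt hfin
  have hm : Measurable fun x => youngExt Φ (g x / l) :=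
    measurable_youngExt.comp (hg.div_const _)
  filter_upwards [ae_lt_top hm (hi.trans_lt ENNReal.one_lt_top).ne] with x hx
  refine lt_top_iff_ne_top.2 fun htop => ?_
  rw [htop, ENNReal.top_div_of_ne_top ENNReal.coe_ne_top, youngExt_top h] at hx
  exact lt_irrefl _ hx

/-! ### Luxemburg norms on balls and powers -/

theorem volume_ball_ne_zero (x : EuclideanSpace ℝ (Fin n)) {r : ℝ} (hr : 0 < r) :
    volume (Metric.ball x r) ≠ 0 := (Metric.measure_ball_pos volume x hr).ne'

theorem volume_ball_ne_top (x : EuclideanSpace ℝ (Fin n)) (r : ℝ) :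
    volume (Metric.ball x r) ≠ ∞ := measure_ball_lt_top.ne

theorem youngInvBall_pos (h : IsYoungFunction Φ) (x : EuclideanSpace ℝ (Fin n)) (r : ℝ) :
    0 < youngInvBall Φ x r :=
  youngInv_pos h (ENNReal.inv_pos.2 (volume_ball_ne_top x r))

theorem youngInvBall_lt_top (h : IsYoungFunction Φ) (x : EuclideanSpace ℝ (Fin n)) {r : ℝ}
    (hr : 0 < r) : youngInvBall Φ x r < ∞ :=
  youngInv_lt_top h (ENNReal.inv_lt_top.2 (Metric.measure_ball_pos volume x hr))

/-- As soon as `K / l` is below `Φ⁻¹(|B|⁻¹)`, one has `Φ(K / l) ≤ |B|⁻¹`, whose integral over `B` is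
at most one. -/
theorem eLuxemburg_indicator_const_le (h : IsYoungFunction Φ) (x : EuclideanSpace ℝ (Fin n))
    {r : ℝ} (hr : 0 < r) (K : ℝ≥0∞) :
    eLuxemburg Φ ((Metric.ball x r).indicator fun _ => K) ≤ K / youngInvBall Φ x r := by
  have hY0 := (youngInvBall_pos h x r).ne'
  have hY := (youngInvBall_lt_top h x hr).ne
  refine le_of_forall_gt_imp_ge_of_dense fun c hc => ?_
  induction c with
  | top => exact le_top
  | coe l =>
  have hl : 0 < l := by exact_mod_cast (zero_le.trans_lt hc : (0 : ℝ≥0∞) < l)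
  refine eLuxemburg_le hl ?_
  have hl0 : (l : ℝ≥0∞) ≠ 0 := by exact_mod_cast hl.ne'
  have hlt : K / l < youngInvBall Φ x r := by
    rw [ENNReal.div_lt_iff (Or.inl hl0) (Or.inl ENNReal.coe_ne_top), mul_comm]
    rwa [ENNReal.div_lt_iff (Or.inl hY0) (Or.inl hY)] at hc
  have hs : youngExt Φ (K / l) ≤ (volume (Metric.ball x r))⁻¹ := by
    refine iSup₂_le fun q hq => ?_
    by_contra! hlt'
    exact absurd ((iInf₂_le q hlt').trans hq) hlt.not_ge
  have e : (fun y => youngExt Φ ((Metric.ball x r).indicator (fun _ => K) y / l))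
      = (Metric.ball x r).indicator fun _ => youngExt Φ (K / l) := by
    ext y
    by_cases hy : y ∈ Metric.ball x r <;> simp [hy, youngExt_zero h]
  rw [e, lintegral_indicator measurableSet_ball, setLIntegral_const]
  exact (mul_le_mul_left hs _).trans
    (ENNReal.inv_mul_cancel (volume_ball_ne_zero x hr) (volume_ball_ne_top x r)).le

/-- A Hölder inequality on a ball: integrate `le_mul_one_add_youngExt` at level `s = |B|⁻¹`. The two
summands contribute `|B|` each, whence the factor 2. -/
theorem setLIntegral_ball_le_eLuxemburg (h : IsYoungFunction Φ) (x : EuclideanSpace ℝ (Fin n))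
    {r : ℝ} (hr : 0 < r) (g : EuclideanSpace ℝ (Fin n) → ℝ≥0∞) :
    ∫⁻ y in Metric.ball x r, g y ≤ 2 * volume (Metric.ball x r) *
      (youngInvBall Φ x r * eLuxemburg Φ ((Metric.ball x r).indicator g)) := by
  set B := Metric.ball x r
  have hB0 : volume B ≠ 0 := volume_ball_ne_zero x hr
  have hB : volume B ≠ ∞ := volume_ball_ne_top x r
  have hY0 := (youngInvBall_pos h x r).ne'
  have hY := (youngInvBall_lt_top h x hr).ne
  have hc0 : 2 * volume B ≠ 0 := mul_ne_zero two_ne_zero hB0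
  have hc : 2 * volume B ≠ ∞ := ENNReal.mul_ne_top ENNReal.ofNat_ne_top hB
  have key : ∀ l q : ℝ≥0, 0 < l → (∫⁻ y, youngExt Φ (B.indicator g y / l) ≤ 1) →
      (volume B)⁻¹ < Φ q → ∫⁻ y in B, g y ≤ 2 * volume B * (q * l) := by
    intro l q hl hi hq
    have hl0 : (l : ℝ≥0∞) ≠ 0 := by exact_mod_cast hl.ne'
    calc ∫⁻ y in B, g y
        ≤ ∫⁻ y in B, (l * q) * (1 + volume B * youngExt Φ (B.indicator g y / l)) := by
          refine setLIntegral_mono' measurableSet_ball fun y hy => ?_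
          have := le_mul_one_add_youngExt h (ENNReal.inv_ne_zero.2 hB) (ENNReal.inv_ne_top.2 hB0)
            hq (B.indicator g y / l)
          rw [div_eq_mul_inv (youngExt _ _), inv_inv, mul_comm (youngExt _ _)] at this
          calc g y = l * (B.indicator g y / l) := by
                rw [ENNReal.mul_div_cancel hl0 ENNReal.coe_ne_top, indicator_of_mem hy]
            _ ≤ _ := by rw [mul_assoc]; gcongr
      _ = (l * q) * (volume B + volume B * ∫⁻ y in B, youngExt Φ (B.indicator g y / l)) := by
          rw [lintegral_const_mul' _ _ (by finiteness), lintegral_add_left measurable_const,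
            lintegral_const_mul' _ _ hB, setLIntegral_const, one_mul]
      _ ≤ (l * q) * (volume B + volume B * 1) := by
          gcongr
          exact (setLIntegral_le_lintegral _ _).trans hi
      _ = _ := by ring
  -- `key` holds for all admissible `l` and `q`; dividing isolates the two infima one after the
  -- other.
  rw [← mul_assoc, mul_comm _ (eLuxemburg _ _), ← ENNReal.div_le_iff (mul_ne_zero hc0 hY0)
    (ENNReal.mul_ne_top hc hY)]
  refine le_iInf fun l => le_iInf₂ fun hl hi => ?_
  have hl0 : (l : ℝ≥0∞) ≠ 0 := by exact_mod_cast hl.ne'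
  rw [ENNReal.div_le_iff (mul_ne_zero hc0 hY0) (ENNReal.mul_ne_top hc hY), mul_left_comm,
    ← mul_assoc, mul_comm, ← ENNReal.div_le_iff (mul_ne_zero hc0 hl0)
    (ENNReal.mul_ne_top hc ENNReal.coe_ne_top)]
  refine le_iInf₂ fun q hq => ?_
  rw [ENNReal.div_le_iff (mul_ne_zero hc0 hl0) (ENNReal.mul_ne_top hc ENNReal.coe_ne_top)]
  exact (key l q hl hi hq).trans (le_of_eq (by ring))

/-- Comparison of Luxemburg norms when a function is controlled by a power of another one. -/
theorem luxemburgNorm_le_of_le_rpow {F : Type*} [NormedAddCommGroup F]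
    {Ψ : ℝ≥0 → ℝ≥0∞} {β : ℝ} (hβ : 0 < β) (hΨ : ∀ r : ℝ≥0, Ψ r = Φ (r ^ (1 / β)))
    {c : ℝ≥0} (hc : 0 < c) {f : EuclideanSpace ℝ (Fin n) → F}
    {g : EuclideanSpace ℝ (Fin n) → ℝ≥0∞} (hfg : ∀ x, ‖f x‖ₑ ≤ c * g x ^ β) :
    luxemburgNorm Ψ f ≤ c * eLuxemburg Φ g ^ β := by
  have hc0 : (c : ℝ≥0∞) ≠ 0 := by exact_mod_cast hc.ne'
  rw [mul_comm, ← ENNReal.div_le_iff hc0 ENNReal.coe_ne_top,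
    ← ENNReal.rpow_inv_le_iff hβ]
  refine le_iInf fun l => le_iInf₂ fun hl hi => ?_
  have hl0 : (l : ℝ≥0∞) ≠ 0 := by exact_mod_cast hl.ne'
  rw [ENNReal.rpow_inv_le_iff hβ, ENNReal.div_le_iff hc0 ENNReal.coe_ne_top]
  have e : (l : ℝ≥0∞) ^ β * c = ((c * l ^ β : ℝ≥0) : ℝ≥0∞) := by
    rw [ENNReal.coe_mul, ENNReal.coe_rpow_of_nonneg _ hβ.le, mul_comm]
  have hpos : 0 < c * l ^ β := mul_pos hc (NNReal.rpow_pos hl)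
  rw [e]
  refine iInf_le_of_le _ (iInf₂_le_of_le hpos (le_trans (lintegral_mono fun x => ?_) hi) le_rfl)
  rw [hΨ]
  refine le_youngExt ?_
  rw [ENNReal.coe_rpow_of_nonneg _ (by positivity), one_div, ENNReal.rpow_inv_le_iff hβ,
    ENNReal.coe_div hpos.ne', ENNReal.div_rpow_of_nonneg _ _ hβ.le, ← enorm_eq_nnnorm]
  refine (ENNReal.div_le_div_right (hfg x) _).trans (le_of_eq ?_)
  rw [ENNReal.coe_mul, ENNReal.mul_div_mul_left _ _ hc0 ENNReal.coe_ne_top,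
    ENNReal.coe_rpow_of_nonneg _ hβ.le]

theorem youngInv_le_rpow {Ψ : ℝ≥0 → ℝ≥0∞} {β : ℝ} (hβ : 0 < β)
    (hΨ : ∀ r : ℝ≥0, Ψ r = Φ (r ^ (1 / β))) (s : ℝ≥0∞) :
    youngInv Ψ s ≤ youngInv Φ s ^ β := by
  rw [← ENNReal.rpow_inv_le_iff hβ]
  refine le_iInf₂ fun r hr => ?_
  rw [ENNReal.rpow_inv_le_iff hβ, ← ENNReal.coe_rpow_of_nonneg _ hβ.le]
  refine iInf₂_le _ ?_
  rwa [hΨ, ← NNReal.rpow_mul, mul_one_div_cancel hβ.ne', NNReal.rpow_one]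

end Luxemburg

/-! ### Maximal functions -/

section Maximal

variable {n : ℕ}

/-- Slightly smaller balls about `x` almost exhaust the integral and lie in `B(z,t)` for `z` near
`x`; no measurability of `g` is needed. -/
theorem lowerSemicontinuous_setLIntegral_ball (g : EuclideanSpace ℝ (Fin n) → ℝ≥0∞) (t : ℝ) :
    LowerSemicontinuous fun x => ∫⁻ y in Metric.ball x t, g y := by
  intro x c (hc : c < ∫⁻ y in Metric.ball x t, g y)
  have hmono : Monotone fun k : ℕ => Metric.ball x (t - 1 / ((k : ℝ) + 1)) := fun i j hij =>
    Metric.ball_subset_ball (sub_le_sub_left (one_div_le_one_div_of_le (by positivity)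
      (by gcongr)) _)
  have hU : Metric.ball x t = ⋃ k : ℕ, Metric.ball x (t - 1 / ((k : ℝ) + 1)) := by
    ext y
    simp only [Metric.mem_ball, mem_iUnion]
    constructor
    · intro h
      obtain ⟨k, hk⟩ := exists_nat_one_div_lt (sub_pos.2 h)
      exact ⟨k, by linarith⟩
    · rintro ⟨k, hk⟩
      have : (0 : ℝ) < 1 / ((k : ℝ) + 1) := by positivity
      linarith
  rw [hU, setLIntegral_iUnion_of_directed _ hmono.directed_le, lt_iSup_iff] at hc
  obtain ⟨k, hk⟩ := hc
  have hpos : (0 : ℝ) < 1 / ((k : ℝ) + 1) := by positivity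
  filter_upwards [Metric.ball_mem_nhds x hpos] with z hz
  refine hk.trans_le (lintegral_mono_set (Metric.ball_subset_ball' ?_))
  rw [Metric.mem_ball, dist_comm] at hz
  linarith

/-- The centred maximal function `sup_{t > 0} |B(x,t)|^p ∫_{B(x,t)} g`. -/
noncomputable def powMaximal (p : ℝ) (g : EuclideanSpace ℝ (Fin n) → ℝ≥0∞)
    (x : EuclideanSpace ℝ (Fin n)) : ℝ≥0∞ :=
  ⨆ (t : ℝ) (_ : 0 < t), volume (Metric.ball x t) ^ p * ∫⁻ y in Metric.ball x t, g y

/-- The centred Hardy-Littlewood maximal function. -/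
noncomputable def hlMaximal (g : EuclideanSpace ℝ (Fin n) → ℝ≥0∞) :
    EuclideanSpace ℝ (Fin n) → ℝ≥0∞ := powMaximal (-1) g

/-- Ball volumes do not depend on the centre, so the weight goes inside the integral and the maximal
function is a supremum of lower semicontinuous functions. -/
theorem measurable_powMaximal (p : ℝ) (g : EuclideanSpace ℝ (Fin n) → ℝ≥0∞) :
    Measurable (powMaximal p g) := by
  refine LowerSemicontinuous.measurable (lowerSemicontinuous_iSup fun t =>
    lowerSemicontinuous_iSup fun ht => ?_)
  have hfin : volume (Metric.ball (0 : EuclideanSpace ℝ (Fin n)) t) ^ p ≠ ∞ :=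
    ENNReal.rpow_ne_top_of_ne_zero (volume_ball_ne_zero 0 ht) (volume_ball_ne_top 0 t)
  have e : (fun x : EuclideanSpace ℝ (Fin n) =>
      volume (Metric.ball x t) ^ p * ∫⁻ y in Metric.ball x t, g y) =
      fun x => ∫⁻ y in Metric.ball x t, volume (Metric.ball (0 : EuclideanSpace ℝ (Fin n)) t) ^ p
        * g y := by
    ext x
    rw [lintegral_const_mul' _ _ hfin, Measure.addHaar_ball_center]
  rw [e]
  exact lowerSemicontinuous_setLIntegral_ball _ t

theorem measurable_hlMaximal (g : EuclideanSpace ℝ (Fin n) → ℝ≥0∞) : Measurable (hlMaximal g) :=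
  measurable_powMaximal _ _

theorem hlMaximal_le_iff {g : EuclideanSpace ℝ (Fin n) → ℝ≥0∞} {x : EuclideanSpace ℝ (Fin n)}
    {c : ℝ≥0∞} : hlMaximal g x ≤ c ↔
      ∀ t, 0 < t → ∫⁻ y in Metric.ball x t, g y ≤ volume (Metric.ball x t) * c := by
  simp only [hlMaximal, powMaximal, iSup_le_iff, ENNReal.rpow_neg_one]
  refine forall₂_congr fun t ht => ?_
  rw [mul_comm, ← div_eq_mul_inv, ENNReal.div_le_iff (volume_ball_ne_zero x ht)
    (volume_ball_ne_top x t), mul_comm]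

theorem setLIntegral_ball_le_hlMaximal (g : EuclideanSpace ℝ (Fin n) → ℝ≥0∞)
    (x : EuclideanSpace ℝ (Fin n)) {t : ℝ} (ht : 0 < t) :
    ∫⁻ y in Metric.ball x t, g y ≤ volume (Metric.ball x t) * hlMaximal g x :=
  hlMaximal_le_iff.1 le_rfl t ht

theorem volume_ball_mul (x y : EuclideanSpace ℝ (Fin n)) {t : ℝ} (ht : 0 < t) (s : ℝ) :
    volume (Metric.ball x (t * s)) = ENNReal.ofReal (t ^ n) * volume (Metric.ball y s) := by
  rw [Measure.addHaar_ball_mul_of_pos _ _ ht, finrank_euclideanSpace_fin,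
    Measure.addHaar_ball_center volume y]

/-- The weak (1,1) inequality, by the Vitali covering lemma with enlargement factor 5. -/
theorem volume_hlMaximal_gt_le (hn : 0 < n) (g : EuclideanSpace ℝ (Fin n) → ℝ≥0∞)
    {s : ℝ≥0∞} (hs0 : s ≠ 0) (hs : s ≠ ∞) :
    s * volume {x | s < hlMaximal g x} ≤ 5 ^ n * ∫⁻ y, g y := by
  have : Nonempty (Fin n) := ⟨⟨0, hn⟩⟩
  rcases eq_or_ne (∫⁻ y, g y) ∞ with htop | hfin
  · rw [htop, ENNReal.mul_top (by positivity)]; exact le_top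
  have h1 : ∀ x : {x | s < hlMaximal g x}, ∃ t : ℝ, 0 < t ∧
      volume (Metric.ball (x : EuclideanSpace ℝ (Fin n)) t) * s
        ≤ ∫⁻ y in Metric.ball (x : EuclideanSpace ℝ (Fin n)) t, g y := by
    rintro ⟨x, hx⟩
    have := mt hlMaximal_le_iff.2 (not_le.2 hx)
    push Not at this
    obtain ⟨t, ht, hlt⟩ := this
    exact ⟨t, ht, hlt.le⟩
  choose r hr0 hr using h1
  -- Vitali needs bounded radii: the selected balls have volume at most `(∫ g) / s`, while the whole
  -- space has infinite volume because `n > 0`.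
  have hbdd : ∃ R : ℝ, ∀ x, r x ≤ R := by
    by_contra! hcon
    have hb : ∀ k : ℕ, volume (Metric.ball (0 : EuclideanSpace ℝ (Fin n)) k) ≤ (∫⁻ y, g y) / s := by
      intro k
      obtain ⟨x, hx⟩ := hcon k
      rw [ENNReal.le_div_iff_mul_le (Or.inl hs0) (Or.inl hs)]
      calc _ ≤ volume (Metric.ball (x : EuclideanSpace ℝ (Fin n)) (r x)) * s := by
            rw [← Measure.addHaar_ball_center volume (x : EuclideanSpace ℝ (Fin n))]
            gcongr
        _ ≤ _ := (hr x).trans (setLIntegral_le_lintegral _ _)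
    have huniv : volume (univ : Set (EuclideanSpace ℝ (Fin n))) ≤ (∫⁻ y, g y) / s := by
      rw [← Metric.iUnion_ball_nat (0 : EuclideanSpace ℝ (Fin n)),
        Monotone.measure_iUnion fun i j hij => Metric.ball_subset_ball (by exact_mod_cast hij)]
      exact iSup_le hb
    rw [measure_univ_of_isAddLeftInvariant] at huniv
    exact absurd huniv (not_le.2 (ENNReal.div_lt_top hfin hs0))
  obtain ⟨R, hR⟩ := hbdd
  obtain ⟨u, -, hdisj, hcov⟩ := Vitali.exists_disjoint_subfamily_covering_enlargement_closedBall
    univ (fun x : {x | s < hlMaximal g x} => (x : EuclideanSpace ℝ (Fin n))) r R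
    (fun a _ => hR a) 5 (by norm_num)
  have hdisj' : u.PairwiseDisjoint fun a => Metric.ball (a : EuclideanSpace ℝ (Fin n)) (r a) :=
    fun a ha b hb hab => (hdisj ha hb hab).mono Metric.ball_subset_closedBall
      Metric.ball_subset_closedBall
  have hcount : u.Countable := hdisj'.countable_of_isOpen (fun _ _ => Metric.isOpen_ball)
    fun a _ => Metric.nonempty_ball.2 (hr0 a)
  have hsub : {x | s < hlMaximal g x} ⊆
      ⋃ b ∈ u, Metric.closedBall (b : EuclideanSpace ℝ (Fin n)) (5 * r b) := by
    intro x hx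
    obtain ⟨b, hb, hxb⟩ := hcov ⟨x, hx⟩ (mem_univ _)
    exact mem_biUnion hb (hxb (Metric.mem_closedBall_self (hr0 _).le))
  have := hcount.to_subtype
  calc s * volume {x | s < hlMaximal g x}
      ≤ s * ∑' b : u, volume (Metric.closedBall (b : EuclideanSpace ℝ (Fin n)) (5 * r b)) := by
        gcongr
        exact (measure_mono hsub).trans (measure_biUnion_le _ hcount _)
    _ = ∑' b : u, 5 ^ n * (volume (Metric.ball (b : EuclideanSpace ℝ (Fin n)) (r b)) * s) := by
        rw [← ENNReal.tsum_mul_left]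
        refine tsum_congr fun b => ?_
        rw [Measure.addHaar_closedBall_eq_addHaar_ball, volume_ball_mul _ b (by norm_num),
          ENNReal.ofReal_pow (by norm_num), ENNReal.ofReal_ofNat]
        ring
    _ ≤ ∑' b : u, 5 ^ n * ∫⁻ y in Metric.ball (b : EuclideanSpace ℝ (Fin n)) (r b), g y :=
        ENNReal.tsum_le_tsum fun b => by gcongr; exact hr b
    _ = 5 ^ n * ∫⁻ y in ⋃ b : u, Metric.ball (b : EuclideanSpace ℝ (Fin n)) (r b), g y := by
        rw [ENNReal.tsum_mul_left, lintegral_iUnion (fun _ => measurableSet_ball)]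
        exact fun a b hab => hdisj' a.2 b.2 (fun h => hab (Subtype.ext h))
    _ ≤ _ := mul_le_mul_right (setLIntegral_le_lintegral _ _) _

theorem hlMaximal_le_add_const {g g' : EuclideanSpace ℝ (Fin n) → ℝ≥0∞} {c : ℝ≥0∞}
    (h : ∀ y, g y ≤ g' y + c) (x : EuclideanSpace ℝ (Fin n)) :
    hlMaximal g x ≤ hlMaximal g' x + c := by
  refine hlMaximal_le_iff.2 fun t ht => ?_
  calc ∫⁻ y in Metric.ball x t, g y ≤ ∫⁻ y in Metric.ball x t, (g' y + c) := lintegral_mono h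
    _ = (∫⁻ y in Metric.ball x t, g' y) + volume (Metric.ball x t) * c := by
      rw [lintegral_add_right _ measurable_const, setLIntegral_const, mul_comm c]
    _ ≤ _ := by
      rw [mul_add]
      gcongr
      exact setLIntegral_ball_le_hlMaximal g' x ht

theorem hlMaximal_div (g : EuclideanSpace ℝ (Fin n) → ℝ≥0∞) {c : ℝ≥0∞} (hc : c ≠ 0)
    (x : EuclideanSpace ℝ (Fin n)) : hlMaximal (fun y => g y / c) x = hlMaximal g x / c := by
  simp only [hlMaximal, powMaximal, div_eq_mul_inv, ENNReal.iSup_mul,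
    lintegral_mul_const' _ _ (ENNReal.inv_ne_top.2 hc), mul_assoc]

/-- The part of `g` with `2 g ≤ s` raises the maximal function by at most `s / 2`, so the weak
inequality at level `s / 2` is needed only for the rest. -/
theorem volume_hlMaximal_gt_le_truncated (hn : 0 < n) (g : EuclideanSpace ℝ (Fin n) → ℝ≥0∞)
    {s : ℝ≥0∞} (hs0 : s ≠ 0) (hs : s ≠ ∞) :
    volume {x | s < hlMaximal g x} ≤
      5 ^ n * (∫⁻ y, {y | s < 2 * g y}.indicator (fun y => 2 * g y) y) / s := by
  have h2 : (2 : ℝ≥0∞) ≠ ∞ := ENNReal.ofNat_ne_top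
  have hs2 : s / 2 ≠ ∞ := ENNReal.div_ne_top hs two_ne_zero
  have hs20 : s / 2 ≠ 0 := ENNReal.div_ne_zero.2 ⟨hs0, h2⟩
  have hle : ∀ x, hlMaximal g x ≤ hlMaximal ({y | s < 2 * g y}.indicator g) x + s / 2 := by
    refine hlMaximal_le_add_const fun y => ?_
    by_cases hy : s < 2 * g y
    · rw [indicator_of_mem (show y ∈ {y | s < 2 * g y} from hy)]; exact le_self_add
    · refine le_trans ?_ le_add_self
      rw [ENNReal.le_div_iff_mul_le (by simp) (by simp), mul_comm]
      exact not_lt.1 hy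
  have hsub : {x | s < hlMaximal g x} ⊆
      {x | s / 2 < hlMaximal ({y | s < 2 * g y}.indicator g) x} := by
    intro x hx
    by_contra hcon
    have : hlMaximal g x ≤ s := (hle x).trans
      ((add_le_add_left (not_lt.1 hcon) _).trans (ENNReal.add_halves s).le)
    exact absurd hx (not_lt.2 this)
  have hw := volume_hlMaximal_gt_le hn ({y | s < 2 * g y}.indicator g) hs20 hs2
  rw [ENNReal.le_div_iff_mul_le (Or.inl hs0) (Or.inl hs)]
  calc volume {x | s < hlMaximal g x} * s
      ≤ volume {x | s / 2 < hlMaximal ({y | s < 2 * g y}.indicator g) x} * s := by gcongr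
    _ = 2 * (s / 2 * volume {x | s / 2 < hlMaximal ({y | s < 2 * g y}.indicator g) x}) := by
      rw [← mul_assoc, ENNReal.mul_div_cancel two_ne_zero h2, mul_comm]
    _ ≤ 2 * (5 ^ n * ∫⁻ y, {y | s < 2 * g y}.indicator g y) := by gcongr
    _ = 5 ^ n * ∫⁻ y, {y | s < 2 * g y}.indicator (fun y => 2 * g y) y := by
      rw [mul_left_comm, ← lintegral_const_mul' _ _ h2]
      congr 2 with y
      by_cases hy : s < 2 * g y <;> simp [indicator, hy]

/-! ### The maximal function on Orlicz spaces -/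

variable {Φ : ℝ≥0 → ℝ≥0∞}

/-- A discrete layer-cake bound: for `a ^ k < r ≤ a ^ (k + 1)` the single term `k` already dominates
`Φ r`. -/
theorem youngExt_le_tsum_zpow (h : IsYoungFunction Φ) {a : ℝ≥0} (ha : 1 < a) (u : ℝ≥0∞) :
    youngExt Φ u ≤ ∑' k : ℤ, {v : ℝ≥0∞ | ((a ^ k : ℝ≥0) : ℝ≥0∞) < v}.indicator
      (fun _ => Φ (a ^ (k + 1))) u := by
  refine iSup₂_le fun r hr => ?_
  rcases eq_or_ne r 0 with rfl | hr0
  · simp [h.map_zero]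
  obtain ⟨k, hk, hk'⟩ := NNReal.exists_mem_Ioc_zpow hr0 ha
  refine le_trans ?_ (ENNReal.le_tsum k)
  have : ((a ^ k : ℝ≥0) : ℝ≥0∞) < u := lt_of_lt_of_le (by exact_mod_cast hk) hr
  rw [indicator_of_mem (show u ∈ {v : ℝ≥0∞ | ((a ^ k : ℝ≥0) : ℝ≥0∞) < v} from this)]
  exact h.monotone hk'

/-- The place where `∇₂` enters: `Φ(a ^ (k + 1)) / a ^ k` is at least halved each time `k` drops by
one. -/
theorem map_zpow_div_le_of_nablaTwo {a : ℝ≥0} (ha : 1 < a)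
    (hN : ∀ r : ℝ≥0, Φ r ≤ (2 * (a : ℝ≥0∞))⁻¹ * Φ (a * r)) (m : ℤ) (j : ℕ) :
    Φ (a ^ (m - j + 1)) / (a ^ (m - j) : ℝ≥0) ≤
      2⁻¹ ^ j * (Φ (a ^ (m + 1)) / (a ^ m : ℝ≥0)) := by
  have ha0 : a ≠ 0 := (zero_lt_one.trans ha).ne'
  have ha0' : (a : ℝ≥0∞) ≠ 0 := by exact_mod_cast ha0
  induction j with
  | zero => simp
  | succ j ih =>
    rw [pow_succ', mul_assoc]
    refine le_trans ?_ (mul_le_mul_right ih _)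
    have e1 : a * a ^ (m - ((j + 1 : ℕ) : ℤ) + 1) = a ^ (m - (j : ℤ) + 1) := by
      rw [← zpow_one_add₀ ha0]; congr 1; push_cast; ring
    have e2 : a ^ (m - (j : ℤ)) = a * a ^ (m - ((j + 1 : ℕ) : ℤ)) := by
      rw [← zpow_one_add₀ ha0]; congr 1; push_cast; ring
    have h1 := hN (a ^ (m - ((j + 1 : ℕ) : ℤ) + 1))
    rw [e1] at h1
    rw [e2]
    have hz : a ^ (m - ((j + 1 : ℕ) : ℤ)) ≠ 0 := zpow_ne_zero _ ha0
    generalize a ^ (m - ((j + 1 : ℕ) : ℤ)) = z at hz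
    have hz' : (z : ℝ≥0∞) ≠ 0 := by exact_mod_cast hz
    refine (ENNReal.div_le_div_right h1 _).trans (le_of_eq ?_)
    rw [ENNReal.coe_mul, div_eq_mul_inv, div_eq_mul_inv,
      ENNReal.mul_inv (Or.inl two_ne_zero) (Or.inl ENNReal.ofNat_ne_top),
      ENNReal.mul_inv (Or.inl ha0') (Or.inl ENNReal.coe_ne_top)]
    ring

/-- Only `k ≤ m` contribute, where `a ^ m < v ≤ a ^ (m + 1)`. By geometric decay the sum is at most
twice the term `k = m`, and that term is at most `a Φ(a v)`. -/
theorem tsum_zpow_le_youngExt (h : IsYoungFunction Φ) {a : ℝ≥0} (ha : 1 < a)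
    (hN : ∀ r : ℝ≥0, Φ r ≤ (2 * (a : ℝ≥0∞))⁻¹ * Φ (a * r)) (v : ℝ≥0∞) :
    ∑' k : ℤ, {v : ℝ≥0∞ | ((a ^ k : ℝ≥0) : ℝ≥0∞) < v}.indicator
      (fun v => Φ (a ^ (k + 1)) / (a ^ k : ℝ≥0) * v) v ≤ 2 * a * youngExt Φ (a * v) := by
  have ha0 : a ≠ 0 := (zero_lt_one.trans ha).ne'
  have ha0' : (a : ℝ≥0∞) ≠ 0 := by exact_mod_cast ha0
  induction v with
  | top =>
    rw [ENNReal.mul_top ha0', youngExt_top h, ENNReal.mul_top (by simp [ha0])]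
    exact le_top
  | coe v =>
  rcases eq_or_ne v 0 with rfl | hv0
  · simp
  obtain ⟨m, hm, hm'⟩ := NNReal.exists_mem_Ioc_zpow hv0 ha
  set D : ℝ≥0∞ := Φ (a ^ (m + 1)) / (a ^ m : ℝ≥0) * v with hD
  have hterm : ∀ k : ℤ, {v : ℝ≥0∞ | ((a ^ k : ℝ≥0) : ℝ≥0∞) < v}.indicator
      (fun v => Φ (a ^ (k + 1)) / (a ^ k : ℝ≥0) * v) v ≤
      if k ≤ m then 2⁻¹ ^ (m - k).toNat * D else 0 := by
    intro k
    by_cases hk : ((a ^ k : ℝ≥0) : ℝ≥0∞) < v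
    · have hkm : k ≤ m := by
        have : a ^ k < a ^ (m + 1) := lt_of_lt_of_le (by exact_mod_cast hk) hm'
        exact Int.lt_add_one_iff.1 ((zpow_lt_zpow_iff_right₀ ha).1 this)
      rw [indicator_of_mem (show (v : ℝ≥0∞) ∈ {v : ℝ≥0∞ | ((a ^ k : ℝ≥0) : ℝ≥0∞) < v} from hk),
        if_pos hkm, hD, ← mul_assoc]
      gcongr
      have := map_zpow_div_le_of_nablaTwo ha hN m (m - k).toNat
      rwa [Int.toNat_of_nonneg (sub_nonneg.2 hkm), sub_sub_cancel] at this
    · rw [indicator_of_notMem (show (v : ℝ≥0∞) ∉ {v : ℝ≥0∞ | ((a ^ k : ℝ≥0) : ℝ≥0∞) < v} from hk)]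
      exact zero_le
  have hsum : ∑' k : ℤ, (if k ≤ m then (2⁻¹ : ℝ≥0∞) ^ (m - k).toNat * D else 0) = 2 * D := by
    have hinj : Function.Injective fun j : ℕ => m - (j : ℤ) := fun i j hij => by
      simpa using hij
    rw [← hinj.tsum_eq]
    · simp only [sub_le_self_iff, Nat.cast_nonneg, if_true, sub_sub_cancel, Int.toNat_natCast]
      rw [ENNReal.tsum_mul_right, ENNReal.tsum_geometric, ENNReal.one_sub_inv_two, inv_inv]
    · intro k hk
      have hkm : k ≤ m := by
        by_contra hcon
        simp [hcon] at hk
      exact ⟨(m - k).toNat, by simp [Int.toNat_of_nonneg (sub_nonneg.2 hkm)]⟩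
  refine (ENNReal.tsum_le_tsum hterm).trans (hsum.le.trans ?_)
  rw [mul_assoc]
  gcongr
  have hz : a ^ m ≠ 0 := zpow_ne_zero _ ha0
  have hz' : ((a ^ m : ℝ≥0) : ℝ≥0∞) ≠ 0 := by exact_mod_cast hz
  have e : a ^ (m + 1) = a * a ^ m := by rw [add_comm, zpow_one_add₀ ha0]
  have h1 : Φ (a ^ (m + 1)) ≤ youngExt Φ (a * v) := by
    refine le_youngExt ?_
    rw [e, ENNReal.coe_mul]
    gcongr
  have h2 : (v : ℝ≥0∞) ≤ a * (a ^ m : ℝ≥0) := by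
    rw [← ENNReal.coe_mul, ← e]; exact_mod_cast hm'
  calc D ≤ youngExt Φ (a * v) / (a ^ m : ℝ≥0) * (a * (a ^ m : ℝ≥0)) := by rw [hD]; gcongr
    _ = a * (youngExt Φ (a * v) / (a ^ m : ℝ≥0) * (a ^ m : ℝ≥0)) := by ring
    _ = a * youngExt Φ (a * v) := by rw [ENNReal.div_mul_cancel hz' ENNReal.coe_ne_top]

/-- The modular inequality for the maximal function under the `∇₂` condition. -/
theorem lintegral_youngExt_hlMaximal_le (hn : 0 < n) (h : IsYoungFunction Φ) {a : ℝ≥0}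
    (ha : 1 < a) (hN : ∀ r : ℝ≥0, Φ r ≤ (2 * (a : ℝ≥0∞))⁻¹ * Φ (a * r))
    {g : EuclideanSpace ℝ (Fin n) → ℝ≥0∞} (hg : AEMeasurable g) :
    ∫⁻ x, youngExt Φ (hlMaximal g x) ≤
      5 ^ n * (2 * a) * ∫⁻ x, youngExt Φ (a * (2 * g x)) := by
  have ha0 : a ≠ 0 := (zero_lt_one.trans ha).ne'
  have hz : ∀ k : ℤ, ((a ^ k : ℝ≥0) : ℝ≥0∞) ≠ 0 := fun k => by
    exact_mod_cast zpow_ne_zero k ha0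
  calc ∫⁻ x, youngExt Φ (hlMaximal g x)
      ≤ ∫⁻ x, ∑' k : ℤ, {v : ℝ≥0∞ | ((a ^ k : ℝ≥0) : ℝ≥0∞) < v}.indicator
          (fun _ => Φ (a ^ (k + 1))) (hlMaximal g x) :=
        lintegral_mono fun x => youngExt_le_tsum_zpow h ha _
    _ = ∑' k : ℤ, Φ (a ^ (k + 1)) * volume {x | ((a ^ k : ℝ≥0) : ℝ≥0∞) < hlMaximal g x} := by
        rw [lintegral_tsum]
        swap
        · exact fun k => ((measurable_const.indicator measurableSet_Ioi).comp
            (measurable_hlMaximal g)).aemeasurable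
        refine tsum_congr fun k => ?_
        exact lintegral_indicator_const (measurable_hlMaximal g measurableSet_Ioi) _
    _ ≤ ∑' k : ℤ, 5 ^ n * ∫⁻ y, {v : ℝ≥0∞ | ((a ^ k : ℝ≥0) : ℝ≥0∞) < v}.indicator
          (fun v => Φ (a ^ (k + 1)) / (a ^ k : ℝ≥0) * v) (2 * g y) := by
        refine ENNReal.tsum_le_tsum fun k => ?_
        have hw := volume_hlMaximal_gt_le_truncated hn g (hz k) ENNReal.coe_ne_top
        calc _ ≤ Φ (a ^ (k + 1)) * (5 ^ n * (∫⁻ y, {y | ((a ^ k : ℝ≥0) : ℝ≥0∞) < 2 * g y}.indicator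
              (fun y => 2 * g y) y) / (a ^ k : ℝ≥0)) := by gcongr
          _ = 5 ^ n * (Φ (a ^ (k + 1)) / (a ^ k : ℝ≥0) *
              ∫⁻ y, {y | ((a ^ k : ℝ≥0) : ℝ≥0∞) < 2 * g y}.indicator (fun y => 2 * g y) y) := by
            simp only [div_eq_mul_inv]; ring
          _ = _ := by
            rw [← lintegral_const_mul'']
            · congr 2 with y
              by_cases hy : ((a ^ k : ℝ≥0) : ℝ≥0∞) < 2 * g y <;> simp [indicator, hy]
            · exact (measurable_id.indicator (measurableSet_Ioi
                (a := ((a ^ k : ℝ≥0) : ℝ≥0∞)))).comp_aemeasurable (hg.const_mul 2)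
    _ = 5 ^ n * ∫⁻ y, ∑' k : ℤ, {v : ℝ≥0∞ | ((a ^ k : ℝ≥0) : ℝ≥0∞) < v}.indicator
          (fun v => Φ (a ^ (k + 1)) / (a ^ k : ℝ≥0) * v) (2 * g y) := by
        rw [ENNReal.tsum_mul_left, lintegral_tsum]
        exact fun k => ((measurable_id.const_mul _).indicator measurableSet_Ioi).comp_aemeasurable
          (hg.const_mul 2)
    _ ≤ 5 ^ n * ∫⁻ y, 2 * a * youngExt Φ (a * (2 * g y)) := by
        gcongr with y
        exact tsum_zpow_le_youngExt h ha hN _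
    _ = _ := by
        rw [lintegral_const_mul' _ _ (by finiteness), ← mul_assoc]

/-- The Hardy-Littlewood maximal operator is bounded on Orlicz spaces with `∇₂`. -/
theorem exists_eLuxemburg_hlMaximal_le (hn : 0 < n) (h : IsYoungFunction Φ) (hN : NablaTwo Φ) :
    ∃ A : ℝ≥0, 0 < A ∧ ∀ g : EuclideanSpace ℝ (Fin n) → ℝ≥0∞, AEMeasurable g →
      eLuxemburg Φ (hlMaximal g) ≤ A * eLuxemburg Φ g := by
  obtain ⟨a, ha, hN⟩ := hN
  have ha0 : 0 < a := zero_lt_one.trans ha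
  -- `W` is the constant of the modular inequality, absorbed by `mul_youngExt_le`; the further `2 *
  -- a` offsets the dilation of the argument there.
  set W : ℝ≥0 := 5 ^ n * (2 * a) with hW
  have hW1 : 1 ≤ W := one_le_mul (one_le_pow₀ (by norm_num)) (one_le_mul one_le_two ha.le)
  have hA0 : 0 < W * (2 * a) := by positivity
  have hA0' : ((W * (2 * a) : ℝ≥0) : ℝ≥0∞) ≠ 0 := by exact_mod_cast hA0.ne'
  refine ⟨W * (2 * a), hA0, fun g hg => ?_⟩
  rw [mul_comm, ← ENNReal.div_le_iff hA0' ENNReal.coe_ne_top]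
  refine le_iInf fun l => le_iInf₂ fun hl hi => ?_
  rw [ENNReal.div_le_iff hA0' ENNReal.coe_ne_top, ← ENNReal.coe_mul]
  refine eLuxemburg_le (by positivity) ?_
  have hc0 : ((l * (W * (2 * a)) : ℝ≥0) : ℝ≥0∞) ≠ 0 := by
    exact_mod_cast (mul_pos hl hA0).ne'
  have hm := lintegral_youngExt_hlMaximal_le hn h ha hN
    (g := fun y => g y / (l * (W * (2 * a)) : ℝ≥0)) (hg.div_const _)
  simp only [hlMaximal_div g hc0] at hm
  have hWe : (5 : ℝ≥0∞) ^ n * (2 * a) = W := by rw [hW]; push_cast; rfl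
  rw [hWe] at hm
  refine hm.trans (le_trans ?_ hi)
  rw [← lintegral_const_mul' _ _ ENNReal.coe_ne_top]
  refine lintegral_mono fun x => (mul_youngExt_le h (by exact_mod_cast hW1) _).trans
    (youngExt_mono (le_of_eq ?_))
  have e : (W : ℝ≥0∞) * (a * (2 * (g x / (l * (W * (2 * a)) : ℝ≥0)))) =
      ((W * (2 * a) : ℝ≥0) : ℝ≥0∞) * g x / (((W * (2 * a) : ℝ≥0) : ℝ≥0∞) * l) := by
    rw [mul_comm l]
    push_cast
    simp only [div_eq_mul_inv]
    ring
  rw [e, ENNReal.mul_div_mul_left _ _ hA0' ENNReal.coe_ne_top]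

end Maximal

/-! ### Generalized Orlicz-Morrey spaces -/

section Morrey

variable {n : ℕ} {Φ : ℝ≥0 → ℝ≥0∞} {φ : EuclideanSpace ℝ (Fin n) → ℝ → ℝ}

theorem youngInvBall_mul_eLuxemburg_le (h : IsYoungFunction Φ) {F : Type*} [NormedAddCommGroup F]
    (f : EuclideanSpace ℝ (Fin n) → F) (x : EuclideanSpace ℝ (Fin n)) {t : ℝ} (ht : 0 < t)
    (hφ : 0 < φ x t) :
    youngInvBall Φ x t * eLuxemburg Φ ((Metric.ball x t).indicator fun y => ‖f y‖ₑ) ≤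
      ENNReal.ofReal (φ x t) * orliczMorreyNorm Φ φ f := by
  have hP0 : ENNReal.ofReal (φ x t) ≠ 0 := (ENNReal.ofReal_pos.2 hφ).ne'
  have h1 : (ENNReal.ofReal (φ x t))⁻¹ * youngInvBall Φ x t *
      luxemburgNorm Φ ((Metric.ball x t).indicator f) ≤ orliczMorreyNorm Φ φ f :=
    le_iSup_of_le x (le_iSup₂_of_le t ht le_rfl)
  rw [luxemburgNorm_eq_eLuxemburg h] at h1
  simp only [enorm_indicator_eq_indicator_enorm] at h1
  rw [mul_assoc, mul_comm, ← div_eq_mul_inv,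
    ENNReal.div_le_iff hP0 ENNReal.ofReal_ne_top] at h1
  rwa [mul_comm (ENNReal.ofReal _)]

/-- The local norm on `B(x,t)` is at most that on `B(x,s)` for every `s > t`, hence is bounded by
the essential infimum over `s` in the supremal condition. -/
theorem youngInvBall_mul_eLuxemburg_le_of_supremal (h : IsYoungFunction Φ)
    {F : Type*} [NormedAddCommGroup F] (hpos : ∀ x r, 0 < r → 0 < φ x r) {C : ℝ≥0}
    {x : EuclideanSpace ℝ (Fin n)} {r : ℝ} (hr : 0 < r)
    (hC : ⨆ (t : ℝ) (_ : r < t), youngInvBall Φ x t *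
        essInf (fun s => ENNReal.ofReal (φ x s) / youngInvBall Φ x s) (volume.restrict (Ioi t))
      ≤ C * ENNReal.ofReal (φ x r)) (f : EuclideanSpace ℝ (Fin n) → F)
    (hfin : orliczMorreyNorm Φ φ f < ∞) {t : ℝ} (ht : r < t) :
    youngInvBall Φ x t * eLuxemburg Φ ((Metric.ball x t).indicator fun y => ‖f y‖ₑ) ≤
      C * ENNReal.ofReal (φ x r) * orliczMorreyNorm Φ φ f := by
  set N := orliczMorreyNorm Φ φ f with hN
  set E := essInf (fun s => ENNReal.ofReal (φ x s) / youngInvBall Φ x s)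
    (volume.restrict (Ioi t)) with hE
  set L := eLuxemburg Φ ((Metric.ball x t).indicator fun y => ‖f y‖ₑ) with hL
  have h1 : ∀ s, t < s → L ≤ ENNReal.ofReal (φ x s) / youngInvBall Φ x s * N := by
    intro s hs
    have hs0 : 0 < s := hr.trans (ht.trans hs)
    have h2 := youngInvBall_mul_eLuxemburg_le h f x hs0 (hpos x s hs0)
    have hmono : L ≤ eLuxemburg Φ ((Metric.ball x s).indicator fun y => ‖f y‖ₑ) :=
      eLuxemburg_mono fun y => indicator_le_indicator_of_subset
        (Metric.ball_subset_ball hs.le) (fun _ => zero_le) y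
    rw [mul_comm, ← ENNReal.le_div_iff_mul_le (Or.inl (youngInvBall_pos h x s).ne')
      (Or.inl (youngInvBall_lt_top h x hs0).ne)] at h2
    refine hmono.trans (h2.trans (le_of_eq ?_))
    simp only [div_eq_mul_inv]; ring
  have h3 : L ≤ E * N := by
    rcases eq_or_ne N 0 with hN0 | hN0
    · simpa [hN0] using h1 (t + 1) (by linarith)
    · rw [← ENNReal.div_le_iff hN0 hfin.ne]
      refine le_essInf_of_ae_le _ ?_
      filter_upwards [ae_restrict_mem measurableSet_Ioi] with s hs
      rw [ENNReal.div_le_iff hN0 hfin.ne]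
      exact h1 s hs
  calc youngInvBall Φ x t * L ≤ youngInvBall Φ x t * (E * N) := by gcongr
    _ = youngInvBall Φ x t * E * N := (mul_assoc _ _ _).symm
    _ ≤ _ := mul_le_mul_left ((le_iSup₂ (f := fun (t : ℝ) (_ : r < t) => youngInvBall Φ x t *
        essInf (fun s => ENNReal.ofReal (φ x s) / youngInvBall Φ x s)
          (volume.restrict (Ioi t))) t ht).trans hC) N

theorem youngInvBall_le_two_mul (h : IsYoungFunction Φ) (x : EuclideanSpace ℝ (Fin n)) (r : ℝ) :
    youngInvBall Φ x r ≤ 2 ^ n * youngInvBall Φ x (2 * r) := by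
  have e : (volume (Metric.ball x r))⁻¹ =
      ((2 ^ n : ℝ≥0) : ℝ≥0∞) * (volume (Metric.ball x (2 * r)))⁻¹ := by
    rw [volume_ball_mul x x two_pos, ENNReal.ofReal_pow (by norm_num), ENNReal.ofReal_ofNat,
      ENNReal.mul_inv (by simp) (by simp), ← mul_assoc]
    push_cast
    rw [ENNReal.mul_inv_cancel (by simp) (by simp), one_mul]
  rw [youngInvBall, e]
  exact (youngInv_mono_of_mul h (one_le_pow₀ one_le_two)).trans (le_of_eq (by push_cast; rfl))

/-- For `t ≤ r` the ball `B(y,t)` lies in `B(x,2r)`. For `t > r` it lies in `B(x,2t)`, of volume `2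
^ n` times larger, where the Hölder bound and `hK` apply. -/
theorem hlMaximal_le_max_of_mem_ball (h : IsYoungFunction Φ)
    {g : EuclideanSpace ℝ (Fin n) → ℝ≥0∞} {x y : EuclideanSpace ℝ (Fin n)} {r : ℝ} {K : ℝ≥0∞}
    (hr : 0 < r)
    (hK : ∀ t, r < t → youngInvBall Φ x t * eLuxemburg Φ ((Metric.ball x t).indicator g) ≤ K)
    (hy : y ∈ Metric.ball x r) :
    hlMaximal g y ≤ max (hlMaximal ((Metric.ball x (2 * r)).indicator g) y) (2 ^ n * 2 * K) := by
  refine hlMaximal_le_iff.2 fun t ht => ?_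
  rcases le_or_gt t r with htr | htr
  · have hsub : Metric.ball y t ⊆ Metric.ball x (2 * r) :=
      Metric.ball_subset_ball' (by rw [Metric.mem_ball] at hy; linarith)
    calc ∫⁻ z in Metric.ball y t, g z
        = ∫⁻ z in Metric.ball y t, (Metric.ball x (2 * r)).indicator g z :=
          setLIntegral_congr_fun measurableSet_ball fun z hz =>
            (indicator_of_mem (hsub hz) g).symm
      _ ≤ _ := (setLIntegral_ball_le_hlMaximal _ y ht).trans
          (by gcongr; exact le_max_left _ _)
  · have hsub : Metric.ball y t ⊆ Metric.ball x (2 * t) :=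
      Metric.ball_subset_ball' (by rw [Metric.mem_ball] at hy; linarith)
    calc ∫⁻ z in Metric.ball y t, g z ≤ ∫⁻ z in Metric.ball x (2 * t), g z :=
          lintegral_mono_set hsub
      _ ≤ 2 * volume (Metric.ball x (2 * t)) * K :=
          (setLIntegral_ball_le_eLuxemburg h x (by linarith) g).trans
            (by gcongr; exact hK _ (by linarith))
      _ = volume (Metric.ball y t) * (2 ^ n * 2 * K) := by
          rw [volume_ball_mul x y two_pos, ENNReal.ofReal_pow (by norm_num), ENNReal.ofReal_ofNat]
          ring
      _ ≤ _ := by gcongr; exact le_max_right _ _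

/-- The local part costs the operator norm `A` times the doubling constant `2 ^ n`; the far part is
a constant on the ball, whose norm cancels `youngInvBall`. -/
theorem youngInvBall_mul_eLuxemburg_hlMaximal_le (h : IsYoungFunction Φ) {A : ℝ≥0}
    (hA : ∀ g : EuclideanSpace ℝ (Fin n) → ℝ≥0∞, AEMeasurable g →
      eLuxemburg Φ (hlMaximal g) ≤ A * eLuxemburg Φ g)
    {g : EuclideanSpace ℝ (Fin n) → ℝ≥0∞} {x : EuclideanSpace ℝ (Fin n)} {r : ℝ} {K : ℝ≥0∞}
    (hr : 0 < r) (hg : AEMeasurable ((Metric.ball x (2 * r)).indicator g))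
    (hK : ∀ t, r < t → youngInvBall Φ x t * eLuxemburg Φ ((Metric.ball x t).indicator g) ≤ K) :
    youngInvBall Φ x r * eLuxemburg Φ ((Metric.ball x r).indicator (hlMaximal g)) ≤
      (2 * (A * 2 ^ n + 2 ^ n * 2) : ℝ≥0) * K := by
  set g₁ := (Metric.ball x (2 * r)).indicator g
  have h1 : eLuxemburg Φ ((Metric.ball x r).indicator (hlMaximal g)) ≤
      2 * (eLuxemburg Φ (hlMaximal g₁) +
        eLuxemburg Φ ((Metric.ball x r).indicator fun _ => 2 ^ n * 2 * K)) := by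
    refine le_trans (eLuxemburg_mono fun y => ?_) (eLuxemburg_max_le h (measurable_hlMaximal g₁))
    by_cases hy : y ∈ Metric.ball x r
    · simpa only [indicator_of_mem hy] using hlMaximal_le_max_of_mem_ball h hr hK hy
    · simp only [indicator_of_notMem hy]; exact zero_le
  have h2 := eLuxemburg_indicator_const_le h x hr (2 ^ n * 2 * K)
  have hY0 := (youngInvBall_pos h x r).ne'
  have hY := (youngInvBall_lt_top h x hr).ne
  calc youngInvBall Φ x r * eLuxemburg Φ ((Metric.ball x r).indicator (hlMaximal g))
      ≤ youngInvBall Φ x r *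
          (2 * (A * eLuxemburg Φ g₁ + 2 ^ n * 2 * K / youngInvBall Φ x r)) := by
        gcongr
        exact h1.trans (by gcongr; exact hA g₁ hg)
    _ = 2 * (A * (youngInvBall Φ x r * eLuxemburg Φ g₁) +
          youngInvBall Φ x r * (2 ^ n * 2 * K / youngInvBall Φ x r)) := by ring
    _ ≤ 2 * (A * (2 ^ n * youngInvBall Φ x (2 * r) * eLuxemburg Φ g₁) + 2 ^ n * 2 * K) := by
        rw [ENNReal.mul_div_cancel hY0 hY]
        gcongr
        exact youngInvBall_le_two_mul h x r
    _ = 2 * (A * (2 ^ n * (youngInvBall Φ x (2 * r) * eLuxemburg Φ g₁)) + 2 ^ n * 2 * K) := by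
        ring
    _ ≤ 2 * (A * (2 ^ n * K) + 2 ^ n * 2 * K) := by gcongr; exact hK _ (by linarith)
    _ = _ := by push_cast; ring

/-! ### The Hedberg inequality -/

theorem le_rpow_mul_rpow_of_le {a u v : ℝ≥0∞} {β : ℝ} (hβ : 0 < β) (hβ1 : β < 1)
    (hu : a ≤ u) (hv : a ≤ v) : a ≤ u ^ β * v ^ (1 - β) := by
  have hb : 0 ≤ 1 - β := by linarith
  calc a = a ^ (β + (1 - β)) := by rw [add_sub_cancel, ENNReal.rpow_one]
    _ = a ^ β * a ^ (1 - β) := ENNReal.rpow_add_of_nonneg _ _ hβ.le hb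
    _ ≤ u ^ β * v ^ (1 - β) := by gcongr

/-- Hedberg-type pointwise bound for the fractional maximal function. -/
theorem exists_powMaximal_le_rpow (hn : 0 < n) {α β : ℝ} (hα : 0 < α)
    (hβ : 0 < β) (hβ1 : β < 1) (hpos : ∀ x r, 0 < r → 0 < φ x r) (hA : AdamsCondition α β φ) :
    ∃ D : ℝ≥0, 0 < D ∧ ∀ (g : EuclideanSpace ℝ (Fin n) → ℝ≥0∞) (N : ℝ≥0∞),
      (∀ x t, 0 < t → ∫⁻ y in Metric.ball x t, g y ≤
        2 * volume (Metric.ball x t) * (ENNReal.ofReal (φ x t) * N)) →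
      ∀ x, powMaximal (-1 + α / (n : ℝ)) g x ≤ D * N ^ (1 - β) * hlMaximal g x ^ β := by
  obtain ⟨C, hC⟩ := hA
  have hn' : (0 : ℝ) < n := by exact_mod_cast hn
  have hb : 0 ≤ 1 - β := by linarith
  set V : ℝ≥0∞ := volume (Metric.ball (0 : EuclideanSpace ℝ (Fin n)) 1) with hV
  have hVfin : V ^ (α / n) ≠ ∞ :=
    ENNReal.rpow_ne_top_of_nonneg (by positivity) (volume_ball_ne_top _ _)
  have hfin : V ^ (α / n) * C * 2 ^ (1 - β) ≠ ∞ := ENNReal.mul_ne_top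
    (ENNReal.mul_ne_top hVfin ENNReal.coe_ne_top)
    (ENNReal.rpow_ne_top_of_nonneg hb ENNReal.ofNat_ne_top)
  -- The added 1 keeps `D` positive, as the later divisions by it require.
  refine ⟨(V ^ (α / n) * C * 2 ^ (1 - β)).toNNReal + 1, by positivity, fun g N hg x => ?_⟩
  refine iSup₂_le fun t ht => ?_
  have hB0 := volume_ball_ne_zero x ht
  have hB := volume_ball_ne_top x t
  set P := ENNReal.ofReal (φ x t) with hP
  have hP0 : P ≠ 0 := (ENNReal.ofReal_pos.2 (hpos x t ht)).ne'
  have hPt : P ≠ ∞ := ENNReal.ofReal_ne_top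
  set H := hlMaximal g x
  set a := (volume (Metric.ball x t))⁻¹ * ∫⁻ y in Metric.ball x t, g y with ha
  have haH : a ≤ H := by
    rw [ha, mul_comm, ← div_eq_mul_inv, ENNReal.div_le_iff hB0 hB, mul_comm]
    exact setLIntegral_ball_le_hlMaximal g x ht
  have haP : a ≤ 2 * (P * N) := by
    rw [ha, mul_comm, ← div_eq_mul_inv, ENNReal.div_le_iff hB0 hB]
    exact (hg x t ht).trans (le_of_eq (by ring))
  have hvol : volume (Metric.ball x t) ^ (α / n) = V ^ (α / n) * ENNReal.ofReal (t ^ α) := by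
    rw [← mul_one t, volume_ball_mul x 0 ht, ENNReal.mul_rpow_of_nonneg _ _ (by positivity),
      mul_one, mul_comm, ENNReal.ofReal_rpow_of_nonneg (by positivity) (by positivity),
      ← Real.rpow_natCast, ← Real.rpow_mul ht.le, mul_div_cancel₀ _ hn'.ne']
  -- The inequality `t^α φ ≤ C φ^β` divided by `φ^β`: the power of `t` exactly compensates the
  -- leftover power of `φ`.
  have hT : ENNReal.ofReal (t ^ α) * P ^ (1 - β) ≤ C := by
    have h1 : ENNReal.ofReal (t ^ α) * P ≤ C * P ^ β := by
      rw [hP, ← ENNReal.ofReal_mul (by positivity),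
        ENNReal.ofReal_rpow_of_pos (hpos x t ht)]
      exact le_self_add.trans (hC x t ht)
    rw [ENNReal.rpow_sub _ _ hP0 hPt, ENNReal.rpow_one, ← mul_div_assoc]
    exact ENNReal.div_le_of_le_mul h1
  calc volume (Metric.ball x t) ^ (-1 + α / (n : ℝ)) * ∫⁻ y in Metric.ball x t, g y
      = volume (Metric.ball x t) ^ (α / n) * a := by
        rw [ENNReal.rpow_add _ _ hB0 hB, ENNReal.rpow_neg_one, ha]; ring
    _ ≤ V ^ (α / n) * ENNReal.ofReal (t ^ α) * (H ^ β * (2 * (P * N)) ^ (1 - β)) := by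
        rw [hvol]; gcongr; exact le_rpow_mul_rpow_of_le hβ hβ1 haH haP
    _ = V ^ (α / n) * (ENNReal.ofReal (t ^ α) * P ^ (1 - β)) * 2 ^ (1 - β) *
          N ^ (1 - β) * H ^ β := by
        rw [ENNReal.mul_rpow_of_nonneg _ _ hb, ENNReal.mul_rpow_of_nonneg _ _ hb]; ring
    _ ≤ V ^ (α / n) * C * 2 ^ (1 - β) * N ^ (1 - β) * H ^ β := by gcongr
    _ ≤ _ := by
        gcongr
        rw [ENNReal.coe_add, ENNReal.coe_toNNReal hfin]
        exact le_self_add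

end Morrey

/-! ### Boundedness of the fractional maximal operator -/

theorem fracMaximal_eq_powMaximal {n : ℕ} {F : Type*} [NormedAddCommGroup F] (α : ℝ)
    (f : EuclideanSpace ℝ (Fin n) → F) :
    fracMaximal α f = powMaximal (-1 + α / (n : ℝ)) fun y => ‖f y‖ₑ := rfl

theorem aemeasurable_indicator_enorm_of_memOrliczLoc {n : ℕ} {F : Type*} [NormedAddCommGroup F]
    {Φ : ℝ≥0 → ℝ≥0∞} {f : EuclideanSpace ℝ (Fin n) → F} (hf : MemOrliczLoc Φ f)
    (x : EuclideanSpace ℝ (Fin n)) {r : ℝ} (hr : 0 < r) :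
    AEMeasurable ((Metric.ball x r).indicator fun y => ‖f y‖ₑ) := by
  simpa only [enorm_indicator_eq_indicator_enorm] using (hf x r hr).1.aestronglyMeasurable.enorm

/-- A function dominated by a power of `g ∈ L^Φ_loc` lies in the corresponding `L^Ψ_loc`. -/
theorem memOrliczLoc_toReal_of_le_rpow {n : ℕ} {Φ Ψ : ℝ≥0 → ℝ≥0∞} (h : IsYoungFunction Φ)
    {β : ℝ} (hβ : 0 < β) (hβ1 : β < 1) (hΨ : ∀ r : ℝ≥0, Ψ r = Φ (r ^ (1 / β)))
    {G g : EuclideanSpace ℝ (Fin n) → ℝ≥0∞} (hG : Measurable G) {c : ℝ≥0} (hc : 0 < c)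
    (hGg : ∀ x, G x ≤ c * g x ^ β)
    (hg : ∀ x r, 0 < r → eLuxemburg Φ ((Metric.ball x r).indicator g) < ∞) :
    MemOrliczLoc Ψ fun x => (G x).toReal := by
  have hreal : ∀ x, ‖(G x).toReal‖ₑ ≤ G x := fun x => by
    rw [Real.enorm_of_nonneg ENNReal.toReal_nonneg]; exact ENNReal.ofReal_toReal_le
  intro x r hr
  constructor
  · refine Integrable.locallyIntegrable ⟨((hG.ennreal_toReal).indicator
      measurableSet_ball).aestronglyMeasurable, ?_⟩
    -- As `β < 1`, integrability of `g` on a ball passes to `g ^ β`.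
    have hle : ∀ u : ℝ≥0∞, u ^ β ≤ 1 + u := by
      intro u
      rcases le_total u 1 with hu | hu
      · exact (ENNReal.rpow_le_one hu hβ.le).trans le_self_add
      · calc u ^ β ≤ u ^ (1 : ℝ) := ENNReal.rpow_le_rpow_of_exponent_le hu hβ1.le
          _ = u := ENNReal.rpow_one u
          _ ≤ 1 + u := le_add_self
    have hH := setLIntegral_ball_le_eLuxemburg h x hr g
    have hHfin : ∫⁻ y in Metric.ball x r, g y < ∞ := hH.trans_lt
      (ENNReal.mul_lt_top (ENNReal.mul_lt_top ENNReal.ofNat_lt_top measure_ball_lt_top)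
        (ENNReal.mul_lt_top (youngInvBall_lt_top h x hr) (hg x r hr)))
    rw [HasFiniteIntegral]
    simp only [enorm_indicator_eq_indicator_enorm]
    rw [lintegral_indicator measurableSet_ball]
    calc ∫⁻ y in Metric.ball x r, ‖(G y).toReal‖ₑ
        ≤ ∫⁻ y in Metric.ball x r, c * (1 + g y) := lintegral_mono fun y =>
          (hreal y).trans ((hGg y).trans (by gcongr; exact hle _))
      _ = c * (volume (Metric.ball x r) + ∫⁻ y in Metric.ball x r, g y) := by
          rw [lintegral_const_mul' _ _ ENNReal.coe_ne_top, lintegral_add_left measurable_const,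
            setLIntegral_const, one_mul]
      _ < ∞ := ENNReal.mul_lt_top ENNReal.coe_lt_top
          (ENNReal.add_lt_top.2 ⟨measure_ball_lt_top, hHfin⟩)
  · have hlux : luxemburgNorm Ψ ((Metric.ball x r).indicator fun x => (G x).toReal) < ∞ := by
      refine (luxemburgNorm_le_of_le_rpow hβ hΨ hc
        (g := (Metric.ball x r).indicator g) fun y => ?_).trans_lt
        (ENNReal.mul_lt_top ENNReal.coe_lt_top (ENNReal.rpow_lt_top_of_nonneg hβ.le (hg x r hr).ne))
      by_cases hy : y ∈ Metric.ball x r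
      · simpa only [indicator_of_mem hy] using (hreal y).trans (hGg y)
      · simp [indicator_of_notMem hy]
    simp only [luxemburgNorm, iInf_lt_iff] at hlux
    obtain ⟨l, hl, hi, -⟩ := hlux
    refine ⟨l⁻¹, inv_pos.2 hl, lt_of_le_of_lt (le_of_eq ?_) (hi.trans_lt ENNReal.one_lt_top)⟩
    simp only [div_eq_inv_mul]

theorem mainTheorem3 {𝕜 : Type*} [RCLike 𝕜] (n : ℕ) (α β : ℝ) (hα : 0 < α) (hαn : α < n)
    (hβ : 0 < β) (hβ1 : β < 1)
    (Φ : ℝ≥0 → ℝ≥0∞) (hΦ : IsYoungFunction Φ) (hΔ : DeltaPrime Φ) (hN : NablaTwo Φ)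
    (φ : EuclideanSpace ℝ (Fin n) → ℝ → ℝ) (hφ : MemOmega Φ φ)
    (hsup : SupremalCondition Φ φ) (hA : AdamsCondition α β φ)
    (Ψ : ℝ≥0 → ℝ≥0∞) (hΨ : ∀ r : ℝ≥0, Ψ r = Φ (r ^ (1 / β)))
    (η : EuclideanSpace ℝ (Fin n) → ℝ → ℝ) (hη : ∀ x r, 0 < r → η x r = φ x r ^ β) :
    ∃ C : ℝ≥0, ∀ f : EuclideanSpace ℝ (Fin n) → 𝕜, MemOrliczMorrey Φ φ f →
      (∀ᵐ x, fracMaximal α f x < ∞) ∧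
      MemOrliczMorrey Ψ η (fun x => (fracMaximal α f x).toReal) ∧
      orliczMorreyNorm Ψ η (fun x => (fracMaximal α f x).toReal)
        ≤ C * orliczMorreyNorm Φ φ f := by
  have hn : 0 < n := by exact_mod_cast hα.trans hαn
  have hb : 0 ≤ 1 - β := by linarith
  obtain ⟨A, -, hHL⟩ := exists_eLuxemburg_hlMaximal_le hn hΦ hN
  obtain ⟨D, hD, hHed⟩ := exists_powMaximal_le_rpow hn hα hβ hβ1 hφ.pos hA
  obtain ⟨S, hS⟩ := hsup
  set E : ℝ≥0 := 2 * (A * 2 ^ n + 2 ^ n * 2) * (S + 1) with hE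
  have hE0 : 0 < E := by positivity
  have hC0 : 0 < D * E ^ β := mul_pos hD (NNReal.rpow_pos hE0)
  refine ⟨D * E ^ β, fun f hf => ?_⟩
  rw [fracMaximal_eq_powMaximal]
  set g : EuclideanSpace ℝ (Fin n) → ℝ≥0∞ := fun y => ‖f y‖ₑ with hg
  set G := powMaximal (-1 + α / (n : ℝ)) g with hG
  set N := orliczMorreyNorm Φ φ f with hNdef
  have hφ0 : ∀ x r, 0 < r → ENNReal.ofReal (φ x r) ≠ 0 := fun x r hr =>
    (ENNReal.ofReal_pos.2 (hφ.pos x r hr)).ne'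
  have hmax : ∀ x r, 0 < r →
      youngInvBall Φ x r * eLuxemburg Φ ((Metric.ball x r).indicator (hlMaximal g)) ≤
        E * (ENNReal.ofReal (φ x r) * N) := by
    intro x r hr
    refine (youngInvBall_mul_eLuxemburg_hlMaximal_le hΦ hHL hr
      (aemeasurable_indicator_enorm_of_memOrliczLoc hf.1 x (by positivity)) fun t ht =>
      youngInvBall_mul_eLuxemburg_le_of_supremal hΦ hφ.pos hr (hS x r hr) f hf.2 ht).trans ?_
    have hS1 : (S : ℝ≥0∞) ≤ (S + 1 : ℝ≥0) := by exact_mod_cast (le_self_add : S ≤ S + 1)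
    rw [hE, ENNReal.coe_mul _ (S + 1), mul_assoc (S : ℝ≥0∞),
      mul_assoc _ ((S + 1 : ℝ≥0) : ℝ≥0∞)]
    exact mul_le_mul_right (mul_le_mul_left hS1 _) _
  have hlux : ∀ x r, 0 < r → eLuxemburg Φ ((Metric.ball x r).indicator (hlMaximal g)) < ∞ := by
    intro x r hr
    have h1 : E * (ENNReal.ofReal (φ x r) * N) < ∞ :=
      ENNReal.mul_lt_top ENNReal.coe_lt_top (ENNReal.mul_lt_top ENNReal.ofReal_lt_top hf.2)
    exact ENNReal.lt_top_of_mul_ne_top_right ((hmax x r hr).trans_lt h1).ne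
      (youngInvBall_pos hΦ x r).ne'
  -- Finite local norms give finiteness almost everywhere on each ball; countably many balls exhaust
  -- the space.
  have hHfin : ∀ᵐ x, hlMaximal g x < ∞ := by
    have h1 : ∀ k : ℕ, ∀ᵐ x,
        (Metric.ball (0 : EuclideanSpace ℝ (Fin n)) (k + 1)).indicator (hlMaximal g) x < ∞ :=
      fun k => ae_lt_top_of_eLuxemburg_lt_top hΦ
        ((measurable_hlMaximal g).indicator measurableSet_ball) (hlux 0 _ (by positivity))
    filter_upwards [ae_all_iff.2 h1] with x hx
    obtain ⟨k, hk⟩ := exists_nat_gt ‖x‖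
    have := hx k
    rwa [indicator_of_mem (by rw [mem_ball_zero_iff]; linarith)] at this
  have hpt : ∀ N' : ℝ≥0, N ≤ N' → ∀ x, G x ≤ (D * N' ^ (1 - β) : ℝ≥0) * hlMaximal g x ^ β := by
    intro N' hN' x
    rw [ENNReal.coe_mul, ENNReal.coe_rpow_of_nonneg _ hb]
    refine hHed g N' (fun x t ht => (setLIntegral_ball_le_eLuxemburg hΦ x ht g).trans ?_) x
    exact mul_le_mul_right ((youngInvBall_mul_eLuxemburg_le hΦ f x ht (hφ.pos x t ht)).trans
      (by gcongr)) _
  -- A positive `N'` replaces `N` because the norm comparison divides by `D * N' ^ (1 - β)`, which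
  -- vanishes when `N = 0`. Letting `N'` decrease to `N` in `hfinal` covers that case too.
  have hnorm : ∀ N' : ℝ≥0, 0 < N' → N ≤ N' →
      orliczMorreyNorm Ψ η (fun x => (G x).toReal) ≤ (D * E ^ β : ℝ≥0) * N' := by
    intro N' hN0 hN'
    have hc : 0 < D * N' ^ (1 - β) := mul_pos hD (NNReal.rpow_pos hN0)
    refine iSup_le fun x => iSup₂_le fun r hr => ?_
    have h1 : luxemburgNorm Ψ ((Metric.ball x r).indicator fun x => (G x).toReal) ≤
        (D * N' ^ (1 - β) : ℝ≥0) *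
          eLuxemburg Φ ((Metric.ball x r).indicator (hlMaximal g)) ^ β := by
      refine luxemburgNorm_le_of_le_rpow hβ hΨ hc fun y => ?_
      by_cases hy : y ∈ Metric.ball x r
      · simp only [indicator_of_mem hy]
        rw [Real.enorm_of_nonneg ENNReal.toReal_nonneg]
        exact ENNReal.ofReal_toReal_le.trans (hpt N' hN' y)
      · simp [indicator_of_notMem hy]
    set P := ENNReal.ofReal (φ x r) with hP
    set L := eLuxemburg Φ ((Metric.ball x r).indicator (hlMaximal g)) with hL
    have hη' : ENNReal.ofReal (η x r) = P ^ β := by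
      rw [hη x r hr, ENNReal.ofReal_rpow_of_pos (hφ.pos x r hr)]
    have h2 : P⁻¹ * (youngInvBall Φ x r * L) ≤ E * N' := by
      rw [mul_comm, ← div_eq_mul_inv, ENNReal.div_le_iff (hφ0 x r hr) ENNReal.ofReal_ne_top]
      calc _ ≤ E * (P * N) := hmax x r hr
        _ ≤ E * (P * N') := by gcongr
        _ = _ := by ring
    calc (ENNReal.ofReal (η x r))⁻¹ * youngInvBall Ψ x r *
          luxemburgNorm Ψ ((Metric.ball x r).indicator fun x => (G x).toReal)
        ≤ (P ^ β)⁻¹ * youngInvBall Φ x r ^ β * ((D * N' ^ (1 - β) : ℝ≥0) * L ^ β) := by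
          rw [hη']
          gcongr
          exact youngInv_le_rpow hβ hΨ _
      _ = (D * N' ^ (1 - β) : ℝ≥0) * (P⁻¹ * (youngInvBall Φ x r * L)) ^ β := by
          rw [ENNReal.mul_rpow_of_nonneg _ _ hβ.le, ENNReal.mul_rpow_of_nonneg _ _ hβ.le,
            ENNReal.inv_rpow]
          ring
      _ ≤ (D * N' ^ (1 - β) : ℝ≥0) * (E * N') ^ β := by gcongr
      _ = _ := by
          rw [← ENNReal.coe_mul E, ← ENNReal.coe_rpow_of_nonneg _ hβ.le, ← ENNReal.coe_mul,
            ← ENNReal.coe_mul, NNReal.mul_rpow]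
          congr 1
          -- The Hedberg factor `N' ^ (1 - β)` and the maximal bound `N' ^ β` recombine to the first
          -- power, so the estimate is linear in the norm.
          calc D * N' ^ (1 - β) * (E ^ β * N' ^ β) = D * E ^ β * (N' ^ (1 - β) * N' ^ β) := by ring
            _ = _ := by rw [← NNReal.rpow_add hN0.ne', sub_add_cancel, NNReal.rpow_one]
  have hfinal : orliczMorreyNorm Ψ η (fun x => (G x).toReal) ≤ (D * E ^ β : ℝ≥0) * N := by
    have hC0' : ((D * E ^ β : ℝ≥0) : ℝ≥0∞) ≠ 0 := by exact_mod_cast hC0.ne'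
    rw [mul_comm, ← ENNReal.div_le_iff hC0' ENNReal.coe_ne_top]
    refine le_of_forall_gt_imp_ge_of_dense fun c hc => ?_
    induction c with
    | top => exact le_top
    | coe c =>
      rw [ENNReal.div_le_iff hC0' ENNReal.coe_ne_top, mul_comm]
      exact hnorm c (by exact_mod_cast (zero_le.trans_lt hc : (0 : ℝ≥0∞) < c)) hc.le
  have hNN : N ≤ (N.toNNReal + 1 : ℝ≥0) := by
    rw [ENNReal.coe_add, ENNReal.coe_toNNReal hf.2.ne]; exact le_self_add
  have hc : 0 < D * (N.toNNReal + 1) ^ (1 - β) := mul_pos hD (NNReal.rpow_pos (by positivity))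
  refine ⟨?_, ⟨memOrliczLoc_toReal_of_le_rpow hΦ hβ hβ1 hΨ (measurable_powMaximal _ _) hc
    (hpt _ hNN) hlux, hfinal.trans_lt (ENNReal.mul_lt_top ENNReal.coe_lt_top hf.2)⟩, hfinal⟩
  filter_upwards [hHfin] with x hx
  exact (hpt _ hNN x).trans_lt (ENNReal.mul_lt_top ENNReal.coe_lt_top
    (ENNReal.rpow_lt_top_of_nonneg hβ.le hx.ne))
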